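/- Let $X,Y,Z$ be the Pauli matrices. A linear map $\Lambda$ on the operators on $(\mathbb{C}^2)^{\otimes n}$ is in SEP if $\Lambda(\rho)=\sum_k K_k\rho K_k^\dagger$ for finitely many operators $K_k$ with $\sum_k K_k^\dagger K_k=\mathbb{1}$, each of which is a tensor product of one-qubit matrices; it is in SEP$_1$ if these one-qubit matrices can moreover all be chosen invertible. For nonzero vectors $\psi,\varphi$, not necessarily normalized, $|\psi\rangle$ can be converted into $|\varphi\rangle$ by SEP (by SEP$_1$) if $\Lambda\big(|\psi\rangle\langle\psi|/\langle\psi|\psi\rangle\big)=|\varphi\rangle\langle\varphi|/\langle\varphi|\varphi\rangle$ for some $\Lambda$ in SEP (in SEP$_1$). The local stabilizer $\mathcal{S}_\psi$ of $|\psi\rangle$ is the set of all tensor products $S$ of invertible one-qubit matrices with $S|\psi\rangle=|\psi\rangle$. The Pauli stabilizer of $|\psi\rangle$ is the set of all $S=c\,\sigma_1\otimes\cdots\otimes\sigma_n$ with $c\in\{\pm1,\pm i\}$, $\sigma_j\in\{\mathbb{1},X,Y,Z\}$ and $S|\psi\rangle=|\psi\rangle$. Let $|\psi\rangle=2^{-5/2}\sum_{x\in\{0,1\}^5}\prod_{i=1}^5(-1)^{x_ix_{i+1}}|x\rangle$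 be the 5-qubit ring graph state, and let $A_i=Z_{i-1}X_iZ_{i+1}$ for $1\le i\le 5$ (indices modulo 5). Let $a\in(0,1/2)$ and $$H=(\tfrac12\mathbb{1}+aZ)\otimes(\tfrac12\mathbb{1}+aX)\otimes(\tfrac12\mathbb{1}+aZ)\otimes\tfrac12\mathbb{1}\otimes\tfrac12\mathbb{1}.$$ Let $$Q_1=\tfrac18(\mathbb{1}+Z)\otimes(\mathbb{1}+X)\otimes(\mathbb{1}-Z)\otimes\mathbb{1}^{\otimes2},\quad Q_2=\tfrac18(\mathbb{1}+Z)\otimes(\mathbb{1}-X)\otimes(\mathbb{1}+Z)\otimes\mathbb{1}^{\otimes2},$$ $$Q_3=\tfrac18(\mathbb{1}-Z)\otimes(\mathbb{1}+X)\otimes(\mathbb{1}+Z)\otimes\mathbb{1}^{\otimes2},\quad Q_4=\tfrac18(\mathbb{1}-Z)\otimes(\mathbb{1}-X)\otimes(\mathbb{1}-Z)\otimes\mathbb{1}^{\otimes2}.$$ Then: 1. The local stabilizer of $|\psi\rangle$ is exactly its Pauli stabilizer, and this is the group generated by $A_1,\dots,A_5$. 2. $\operatorname{tr}(HA_2)\neq0$.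 3. $Q_1,\dots,Q_4$ are orthogonal projectors and $Q_i|\psi\rangle=0$ for each $i$. 4. There is a tensor product $h$ of five invertible one-qubit matrices with $h^\dagger h=H$, and for every such $h$ the following hold. - The eight operators $M_i=2\sqrt{\frac{2a^3}{(1/2+a)^2(1/2-a)(1/8+a^3)}}\;hQ_i$ for $i=1,2,3$, $M_4=2\sqrt{\frac{2a^3}{(1/2-a)^3(1/8+a^3)}}\;hQ_4$, $M_5=\sqrt{\frac{1}{1/8+a^3}}\;h$, $M_6=M_5A_1$, $M_7=M_5A_3$, $M_8=M_5A_1A_3$ are tensor products of one-qubit matrices and satisfy $\sum_kM_k^\dagger M_k=\mathbb{1}$, and the map $\rho\mapsto\sum_kM_k\rho M_k^\dagger$ sends $|\psi\rangle\langle\psi|$ to $h|\psi\rangle\langle\psi|h^\dagger/\langle\psi|H|\psi\rangle$. In particular $|\psi\rangle$ can be converted into $h|\psi\rangle$ by SEP. - $|\psi\rangle$ cannot be converted into $h|\psi\rangle$ by SEP$_1$. -/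

import Mathlib

open Matrix

noncomputable section

/-- Labels of the computational basis of `n` qubits. -/
abbrev QubitIndex (n : ℕ) : Type := Fin n → Fin 2

/-- Operators on the Hilbert space of `n` qubits, as matrices in the computational basis. -/
abbrev QubitOp (n : ℕ) : Type := Matrix (QubitIndex n) (QubitIndex n) ℂ

/-- Vectors of the Hilbert space of `n` qubits, as coordinate vectors in the computational basis. -/
abbrev QubitVec (n : ℕ) : Type := QubitIndex n → ℂ

/-- The tensor product `A 0 ⊗ A 1 ⊗ ⋯ ⊗ A (n - 1)` of one-qubit operators. -/
def tensorOp {n : ℕ} (A : Fin n → Matrix (Fin 2) (Fin 2) ℂ) : QubitOp n :=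
  Matrix.of fun x y => ∏ j, A j (x j) (y j)

theorem tensorOp_mul {n : ℕ} (A B : Fin n → Matrix (Fin 2) (Fin 2) ℂ) :
    tensorOp A * tensorOp B = tensorOp (fun j => A j * B j) := by
  ext x y
  simp only [tensorOp, Matrix.mul_apply, Matrix.of_apply, ← Finset.prod_mul_distrib]
  rw [Finset.prod_univ_sum, Fintype.piFinset_univ]

theorem tensorOp_one {n : ℕ} : tensorOp (fun _ : Fin n => 1) = 1 := by
  ext x y
  simp only [tensorOp, Matrix.of_apply, Matrix.one_apply]
  by_cases h : x = y
  · simp [h]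
  · obtain ⟨j, hj⟩ := Function.ne_iff.mp h
    rw [if_neg h]
    exact Finset.prod_eq_zero (Finset.mem_univ j) (if_neg hj)

/-- The one-qubit Pauli matrix `X`. -/
def pauliX : Matrix (Fin 2) (Fin 2) ℂ := !![0, 1; 1, 0]

/-- The one-qubit Pauli matrix `Y`. -/
def pauliY : Matrix (Fin 2) (Fin 2) ℂ := !![0, -Complex.I; Complex.I, 0]

/-- The one-qubit Pauli matrix `Z`. -/
def pauliZ : Matrix (Fin 2) (Fin 2) ℂ := !![1, 0; 0, -1]

theorem pauliX_mul_self : pauliX * pauliX = 1 := by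
  ext i j; fin_cases i <;> fin_cases j <;> simp [pauliX]

theorem pauliZ_mul_self : pauliZ * pauliZ = 1 := by
  ext i j; fin_cases i <;> fin_cases j <;> simp [pauliZ]

/-- A local operator: a tensor product of arbitrary one-qubit matrices. -/
def IsLocalOp {n : ℕ} (M : QubitOp n) : Prop :=
  ∃ K : Fin n → Matrix (Fin 2) (Fin 2) ℂ, M = tensorOp K

/-- A regular local operator: a tensor product of invertible one-qubit matrices. -/
def IsRegularLocalOp {n : ℕ} (M : QubitOp n) : Prop :=
  ∃ K : Fin n → GL (Fin 2) ℂ, M = tensorOp (fun j => (K j : Matrix (Fin 2) (Fin 2) ℂ))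

/-- The map `X ↦ ∑ k, K k * X * (K k)ᴴ` with the finite family of Kraus operators `K`. -/
def krausMap {n m : ℕ} (K : Fin m → QubitOp n) : QubitOp n →ₗ[ℂ] QubitOp n where
  toFun X := ∑ k, K k * X * (K k)ᴴ
  map_add' X Y := by simp [mul_add, add_mul, Finset.sum_add_distrib]
  map_smul' c X := by simp [Finset.smul_sum]

/-- The completeness (trace preservation) relation `∑ k, (K k)ᴴ * K k = 1`. -/
def KrausComplete {n m : ℕ} (K : Fin m → QubitOp n) : Prop :=
  ∑ k, (K k)ᴴ * K k = 1

/-- The class SEP: completely positive trace-preserving maps that have a Kraus decomposition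
all of whose Kraus operators are local. -/
def IsSEP {n : ℕ} (Λ : QubitOp n →ₗ[ℂ] QubitOp n) : Prop :=
  ∃ (m : ℕ) (K : Fin m → QubitOp n),
    (∀ k, IsLocalOp (K k)) ∧ KrausComplete K ∧ Λ = krausMap K

/-- The class SEP₁: completely positive trace-preserving maps that have a Kraus decomposition
all of whose Kraus operators are local and regular. -/
def IsSEP₁ {n : ℕ} (Λ : QubitOp n →ₗ[ℂ] QubitOp n) : Prop :=
  ∃ (m : ℕ) (K : Fin m → QubitOp n),
    (∀ k, IsRegularLocalOp (K k)) ∧ KrausComplete K ∧ Λ = krausMap K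

/-- The density matrix `|ψ⟩⟨ψ| / ⟨ψ|ψ⟩` of the pure state given by a (nonzero, not necessarily
normalized) vector `ψ`. -/
def pureDensity {n : ℕ} (ψ : QubitVec n) : QubitOp n :=
  (star ψ ⬝ᵥ ψ)⁻¹ • Matrix.vecMulVec ψ (star ψ)

/-- `ψ` can be converted into `φ` by SEP. -/
def ConvertibleBySEP {n : ℕ} (ψ φ : QubitVec n) : Prop :=
  ∃ Λ : QubitOp n →ₗ[ℂ] QubitOp n, IsSEP Λ ∧ Λ (pureDensity ψ) = pureDensity φ

/-- `ψ` can be converted into `φ` by SEP₁. -/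
def ConvertibleBySEP₁ {n : ℕ} (ψ φ : QubitVec n) : Prop :=
  ∃ Λ : QubitOp n →ₗ[ℂ] QubitOp n, IsSEP₁ Λ ∧ Λ (pureDensity ψ) = pureDensity φ

/-- The local stabilizer of `ψ`: all regular local operators `S` with `S ψ = ψ`. -/
def localStabilizer {n : ℕ} (ψ : QubitVec n) : Set (GL (QubitIndex n) ℂ) :=
  {S | (S : QubitOp n) *ᵥ ψ = ψ ∧ IsRegularLocalOp (S : QubitOp n)}

/-- The Pauli stabilizer of `ψ`: all elements `c • (σ 0 ⊗ ⋯ ⊗ σ (n - 1))` of the `n`-qubit Pauli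
group, `c ∈ {1, -1, i, -i}` and `σ j ∈ {1, X, Y, Z}`, that leave `ψ` invariant. -/
def pauliStabilizer {n : ℕ} (ψ : QubitVec n) : Set (GL (QubitIndex n) ℂ) :=
  {S | (S : QubitOp n) *ᵥ ψ = ψ ∧
    ∃ c ∈ ({1, -1, Complex.I, -Complex.I} : Set ℂ),
    ∃ σ : Fin n → Matrix (Fin 2) (Fin 2) ℂ,
      (∀ j, σ j ∈ ({1, pauliX, pauliY, pauliZ} : Set (Matrix (Fin 2) (Fin 2) ℂ))) ∧
      (S : QubitOp n) = c • tensorOp σ}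

/-- The 5-qubit ring graph state: the product of the controlled-`Z` gates on the pairs `{i, i+1}`
(indices mod 5), applied to `|+⟩^{⊗5}`. -/
def ringState : QubitVec 5 :=
  fun x => ((Real.sqrt (2 ^ 5))⁻¹ : ℝ) * ∏ i : Fin 5, (-1 : ℂ) ^ ((x i : ℕ) * (x (i + 1) : ℕ))

/-- The tensor factors of `Z_{i-1} X_i Z_{i+1}` (indices mod 5). -/
def ringFactor (i j : Fin 5) : Matrix (Fin 2) (Fin 2) ℂ :=
  if j = i then pauliX else if j = i - 1 ∨ j = i + 1 then pauliZ else 1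

theorem ringFactor_mul_self (i j : Fin 5) : ringFactor i j * ringFactor i j = 1 := by
  unfold ringFactor
  split_ifs
  · exact pauliX_mul_self
  · exact pauliZ_mul_self
  · exact one_mul 1

theorem tensorOp_ringFactor_mul_self (i : Fin 5) :
    tensorOp (ringFactor i) * tensorOp (ringFactor i) = 1 := by
  rw [tensorOp_mul, show (fun j => ringFactor i j * ringFactor i j) = fun _ => 1 from
    funext (ringFactor_mul_self i), tensorOp_one]

/-- The operator `Z_{i-1} X_i Z_{i+1}` on five qubits (indices mod 5, starting at `0`). -/
def ringA (i : Fin 5) : GL (QubitIndex 5) ℂ where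
  val := tensorOp (ringFactor i)
  inv := tensorOp (ringFactor i)
  val_inv := tensorOp_ringFactor_mul_self i
  inv_val := tensorOp_ringFactor_mul_self i

/-- `H = (½ + aZ) ⊗ (½ + aX) ⊗ (½ + aZ) ⊗ ½ ⊗ ½`. -/
def ringH (a : ℝ) : QubitOp 5 :=
  tensorOp ![(1 / 2 : ℂ) • 1 + (a : ℂ) • pauliZ, (1 / 2 : ℂ) • 1 + (a : ℂ) • pauliX,
    (1 / 2 : ℂ) • 1 + (a : ℂ) • pauliZ, (1 / 2 : ℂ) • 1, (1 / 2 : ℂ) • 1]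

/-- The four operators `⅛ (1 ± Z) ⊗ (1 ± X) ⊗ (1 ± Z) ⊗ 1 ⊗ 1` with sign patterns
`(+,+,-)`, `(+,-,+)`, `(-,+,+)`, `(-,-,-)`. -/
def ringQ : Fin 4 → QubitOp 5 :=
  ![(1 / 8 : ℂ) • tensorOp ![1 + pauliZ, 1 + pauliX, 1 - pauliZ, 1, 1],
    (1 / 8 : ℂ) • tensorOp ![1 + pauliZ, 1 - pauliX, 1 + pauliZ, 1, 1],
    (1 / 8 : ℂ) • tensorOp ![1 - pauliZ, 1 + pauliX, 1 + pauliZ, 1, 1],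
    (1 / 8 : ℂ) • tensorOp ![1 - pauliZ, 1 - pauliX, 1 - pauliZ, 1, 1]]

/-- The coefficient of `h * Q` for the first three projectors. -/
def ringCoeff₁ (a : ℝ) : ℝ :=
  2 * Real.sqrt (2 * a ^ 3 / ((1 / 2 + a) ^ 2 * (1 / 2 - a) * (1 / 8 + a ^ 3)))

/-- The coefficient of `h * Q` for the fourth projector. -/
def ringCoeff₄ (a : ℝ) : ℝ :=
  2 * Real.sqrt (2 * a ^ 3 / ((1 / 2 - a) ^ 3 * (1 / 8 + a ^ 3)))

/-- The coefficient of the remaining four Kraus operators. -/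
def ringCoeff₅ (a : ℝ) : ℝ := Real.sqrt (1 / (1 / 8 + a ^ 3))

/-- The eight Kraus operators built from an operator `h`. -/
def ringKraus (a : ℝ) (h : QubitOp 5) : Fin 8 → QubitOp 5 :=
  ![(ringCoeff₁ a : ℂ) • (h * ringQ 0),
    (ringCoeff₁ a : ℂ) • (h * ringQ 1),
    (ringCoeff₁ a : ℂ) • (h * ringQ 2),
    (ringCoeff₄ a : ℂ) • (h * ringQ 3),
    (ringCoeff₅ a : ℂ) • h,
    (ringCoeff₅ a : ℂ) • (h * (ringA 0 : QubitOp 5)),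
    (ringCoeff₅ a : ℂ) • (h * (ringA 2 : QubitOp 5)),
    (ringCoeff₅ a : ℂ) • (h * (ringA 0 : QubitOp 5) * (ringA 2 : QubitOp 5))]

end

/-! Indices start at 0, so the decisive generator is `ringA 1` = Z⊗X⊗Z⊗1⊗1.

Stabilizer: cut the ring into qubits 0,1,2 and 3,4. If a product operator fixes the state, its first
three factors preserve the support of the reduced state, which is the +1 eigenspace of Z⊗X⊗Z. A
product vector fixed by Z⊗X⊗Z has eigenvectors as factors, and suitable test vectors
|a⟩⊗(|0⟩+(-1)^a|1⟩)⊗|0⟩ show that the first factor sends each |a⟩ to a multiple of a basis vector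
(`localStabilizer_column`). By rotation all five factors are monomial. Multiplying by a generator
product with the same bit flips leaves a diagonal operator, and a diagonal operator fixing a state
without zero amplitudes is 1 (`mem_closure_ringA_of_isShiftOp`).

SEP: conjugating H by the four products of `ringA 0` and `ringA 2` and adding leaves (1/8)·1 + a³
Z⊗X⊗Z. The four Q add up to (1 - Z⊗X⊗Z)/2, so 2a³ times their sum cancels the second term
(`ringKraus_sum_identity`), and they cost nothing because they annihilate the state.

SEP₁: an invertible Kraus operator must be c·h·S with S in the stabilizer
(`exists_eq_smul_mul_stabilizer`). As S is unitary and commutes with `ringA 1`, completeness paired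
with `ringA 1` under the trace gives 0 = ∑|c|²·8a³, which is impossible. -/

/-! ### Algebra of tensor products of one-qubit matrices. -/

theorem conjTranspose_tensorOp {n : ℕ} (A : Fin n → Matrix (Fin 2) (Fin 2) ℂ) :
    (tensorOp A)ᴴ = tensorOp (fun j => (A j)ᴴ) := by
  ext x y
  simp [tensorOp, Matrix.conjTranspose_apply]

theorem trace_tensorOp {n : ℕ} (A : Fin n → Matrix (Fin 2) (Fin 2) ℂ) :
    (tensorOp A).trace = ∏ j, (A j).trace := by
  simp only [Matrix.trace, Matrix.diag, tensorOp, Matrix.of_apply]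
  rw [Finset.prod_univ_sum, Fintype.piFinset_univ]

theorem smul_tensorOp {n : ℕ} (c : Fin n → ℂ) (A : Fin n → Matrix (Fin 2) (Fin 2) ℂ) :
    tensorOp (fun j => c j • A j) = (∏ j, c j) • tensorOp A := by
  ext x y
  simp [tensorOp, Finset.prod_mul_distrib]

theorem smul_tensorOp_eq {n : ℕ} (c : ℂ) (A : Fin (n + 1) → Matrix (Fin 2) (Fin 2) ℂ) :
    c • tensorOp A = tensorOp (fun j => (if j = 0 then c else 1) • A j) := by
  rw [smul_tensorOp]
  simp

theorem IsLocalOp.mul {n : ℕ} {M N : QubitOp n} (hM : IsLocalOp M) (hN : IsLocalOp N) :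
    IsLocalOp (M * N) := by
  obtain ⟨A, rfl⟩ := hM
  obtain ⟨B, rfl⟩ := hN
  exact ⟨_, tensorOp_mul A B⟩

theorem IsLocalOp.smul {n : ℕ} {M : QubitOp (n + 1)} (c : ℂ) (hM : IsLocalOp M) :
    IsLocalOp (c • M) := by
  obtain ⟨A, rfl⟩ := hM
  exact ⟨_, smul_tensorOp_eq c A⟩

theorem IsRegularLocalOp.isLocalOp {n : ℕ} {M : QubitOp n} (hM : IsRegularLocalOp M) :
    IsLocalOp M := by
  obtain ⟨K, rfl⟩ := hM
  exact ⟨_, rfl⟩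

theorem isRegularLocalOp_tensorOp {n : ℕ} {A : Fin n → Matrix (Fin 2) (Fin 2) ℂ}
    (hA : ∀ j, IsUnit (A j)) : IsRegularLocalOp (tensorOp A) := by
  choose u hu using hA
  exact ⟨u, by simp only [hu]⟩

theorem IsRegularLocalOp.mul {n : ℕ} {M N : QubitOp n} (hM : IsRegularLocalOp M)
    (hN : IsRegularLocalOp N) : IsRegularLocalOp (M * N) := by
  obtain ⟨A, rfl⟩ := hM
  obtain ⟨B, rfl⟩ := hN
  exact ⟨fun j => A j * B j, by simp [tensorOp_mul]⟩

theorem IsRegularLocalOp.smul {n : ℕ} {M : QubitOp (n + 1)} {c : ℂ} (hc : c ≠ 0)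
    (hM : IsRegularLocalOp M) : IsRegularLocalOp (c • M) := by
  obtain ⟨A, rfl⟩ := hM
  rw [smul_tensorOp_eq]
  refine isRegularLocalOp_tensorOp fun j => ?_
  have h : (if j = 0 then c else 1) ≠ 0 := by split_ifs <;> simp [hc]
  exact (A j).isUnit.smul (Units.mk0 _ h)

/-- A regular local operator has a regular local inverse. -/
theorem IsRegularLocalOp.exists_inv {n : ℕ} {M : QubitOp n} (hM : IsRegularLocalOp M) :
    ∃ N : QubitOp n, IsRegularLocalOp N ∧ M * N = 1 ∧ N * M = 1 := by
  obtain ⟨A, rfl⟩ := hM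
  refine ⟨_, ⟨fun j => (A j)⁻¹, rfl⟩, ?_, ?_⟩ <;> rw [tensorOp_mul, ← tensorOp_one] <;>
    congr 1 <;> funext j
  · exact Units.mul_inv (A j)
  · exact Units.inv_mul (A j)

/-- The product vector `v 0 ⊗ v 1 ⊗ ⋯ ⊗ v (n - 1)`. -/
def tensorVec {n : ℕ} (v : Fin n → Fin 2 → ℂ) : QubitVec n := fun x => ∏ j, v j (x j)

theorem tensorOp_mulVec_tensorVec {n : ℕ} (A : Fin n → Matrix (Fin 2) (Fin 2) ℂ)
    (v : Fin n → Fin 2 → ℂ) : tensorOp A *ᵥ tensorVec v = tensorVec fun j => A j *ᵥ v j := by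
  ext x
  simp only [tensorOp, tensorVec, Matrix.mulVec, dotProduct, Matrix.of_apply,
    ← Finset.prod_mul_distrib]
  rw [Finset.prod_univ_sum, Fintype.piFinset_univ]

/-! ### Pauli matrices and phases. -/

theorem isHermitian_pauliX : pauliXᴴ = pauliX := by
  ext i j; fin_cases i <;> fin_cases j <;> simp [pauliX]

theorem isHermitian_pauliZ : pauliZᴴ = pauliZ := by
  ext i j; fin_cases i <;> fin_cases j <;> simp [pauliZ]

theorem pauliY_mul_self : pauliY * pauliY = 1 := by
  ext i j; fin_cases i <;> fin_cases j <;> simp [pauliY]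

theorem pauliX_mul_pauliZ : pauliX * pauliZ = -(pauliZ * pauliX) := by
  ext i j; fin_cases i <;> fin_cases j <;> simp [pauliX, pauliZ]

theorem pauliZ_mul_pauliX : pauliZ * pauliX = Complex.I • pauliY := by
  ext i j; fin_cases i <;> fin_cases j <;> simp [pauliX, pauliY, pauliZ]

theorem pauliY_mul_pauliZ : pauliY * pauliZ = Complex.I • pauliX := by
  ext i j; fin_cases i <;> fin_cases j <;> simp [pauliX, pauliY, pauliZ]

theorem pauliZ_mul_pauliY : pauliZ * pauliY = (-Complex.I) • pauliX := by
  ext i j; fin_cases i <;> fin_cases j <;> simp [pauliX, pauliY, pauliZ]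

theorem pauliX_mul_pauliY : pauliX * pauliY = Complex.I • pauliZ := by
  ext i j; fin_cases i <;> fin_cases j <;> simp [pauliX, pauliY, pauliZ]

theorem pauliY_mul_pauliX : pauliY * pauliX = (-Complex.I) • pauliZ := by
  ext i j; fin_cases i <;> fin_cases j <;> simp [pauliX, pauliY, pauliZ]

/-- The phases of the Pauli group. -/
theorem mem_phases_iff (c : ℂ) :
    c ∈ ({1, -1, Complex.I, -Complex.I} : Set ℂ) ↔ c ^ 4 = 1 := by
  have : c ^ 4 - 1 = (c - 1) * (c + 1) * (c - Complex.I) * (c + Complex.I) := by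
    linear_combination (c ^ 2 - 1) * Complex.I_sq
  rw [← sub_eq_zero (b := (1 : ℂ)), this]
  simp [sub_eq_zero, add_eq_zero_iff_eq_neg, or_assoc]

theorem pauli_mul_pauli {σ τ : Matrix (Fin 2) (Fin 2) ℂ}
    (hσ : σ ∈ ({1, pauliX, pauliY, pauliZ} : Set (Matrix (Fin 2) (Fin 2) ℂ)))
    (hτ : τ ∈ ({1, pauliX, pauliY, pauliZ} : Set (Matrix (Fin 2) (Fin 2) ℂ))) :
    ∃ c : ℂ, c ^ 4 = 1 ∧
      ∃ μ ∈ ({1, pauliX, pauliY, pauliZ} : Set (Matrix (Fin 2) (Fin 2) ℂ)), σ * τ = c • μ := by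
  have hXZ : pauliX * pauliZ = (-Complex.I) • pauliY := by
    rw [pauliX_mul_pauliZ, pauliZ_mul_pauliX, neg_smul]
  have hI : (-Complex.I) ^ 4 = 1 := by rw [Even.neg_pow (by decide), Complex.I_pow_four]
  have h1 : (1 : ℂ) ^ 4 = 1 := one_pow 4
  have e {A B : Matrix (Fin 2) (Fin 2) ℂ} (h : A = B) : A = (1 : ℂ) • B := by rw [one_smul, h]
  rcases hσ with rfl | rfl | rfl | rfl <;> rcases hτ with rfl | rfl | rfl | rfl
  · exact ⟨1, h1, 1, by simp, e (by simp)⟩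
  · exact ⟨1, h1, pauliX, by simp, e (by simp)⟩
  · exact ⟨1, h1, pauliY, by simp, e (by simp)⟩
  · exact ⟨1, h1, pauliZ, by simp, e (by simp)⟩
  · exact ⟨1, h1, pauliX, by simp, e (by simp)⟩
  · exact ⟨1, h1, 1, by simp, e pauliX_mul_self⟩
  · exact ⟨_, Complex.I_pow_four, pauliZ, by simp, pauliX_mul_pauliY⟩
  · exact ⟨_, hI, pauliY, by simp, hXZ⟩
  · exact ⟨1, h1, pauliY, by simp, e (by simp)⟩
  · exact ⟨_, hI, pauliZ, by simp, pauliY_mul_pauliX⟩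
  · exact ⟨1, h1, 1, by simp, e pauliY_mul_self⟩
  · exact ⟨_, Complex.I_pow_four, pauliX, by simp, pauliY_mul_pauliZ⟩
  · exact ⟨1, h1, pauliZ, by simp, e (by simp)⟩
  · exact ⟨_, Complex.I_pow_four, pauliY, by simp, pauliZ_mul_pauliX⟩
  · exact ⟨_, hI, pauliX, by simp, pauliZ_mul_pauliY⟩
  · exact ⟨1, h1, 1, by simp, e pauliZ_mul_self⟩

theorem pauli_mul_self {σ : Matrix (Fin 2) (Fin 2) ℂ}
    (hσ : σ ∈ ({1, pauliX, pauliY, pauliZ} : Set (Matrix (Fin 2) (Fin 2) ℂ))) : σ * σ = 1 := by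
  rcases hσ with rfl | rfl | rfl | rfl
  · simp
  · exact pauliX_mul_self
  · exact pauliY_mul_self
  · exact pauliZ_mul_self

theorem isUnit_pauli {σ : Matrix (Fin 2) (Fin 2) ℂ}
    (hσ : σ ∈ ({1, pauliX, pauliY, pauliZ} : Set (Matrix (Fin 2) (Fin 2) ℂ))) : IsUnit σ :=
  ⟨⟨σ, σ, pauli_mul_self hσ, pauli_mul_self hσ⟩, rfl⟩

/-! ### Kraus maps between pure states. -/

open scoped ComplexOrder in
theorem star_dotProduct_self_eq_zero_iff {n : ℕ} {ψ : QubitVec n} : star ψ ⬝ᵥ ψ = 0 ↔ ψ = 0 :=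
  dotProduct_star_self_eq_zero

/-- If the conversion of `ψ` into `φ` succeeds on every branch, then the Kraus map converts. -/
theorem krausMap_pureDensity {n m : ℕ} {K : Fin m → QubitOp n} (hK : KrausComplete K)
    {ψ φ : QubitVec n} (hψ : ψ ≠ 0) (c : Fin m → ℂ) (hc : ∀ k, K k *ᵥ ψ = c k • φ) :
    krausMap K (pureDensity ψ) = pureDensity φ := by
  have hψ' : star ψ ⬝ᵥ ψ ≠ 0 := mt star_dotProduct_self_eq_zero_iff.mp hψ
  -- Trace preservation: the weights ∑|c k|² compare the two squared norms. This forces φ ≠ 0 and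
  -- fixes the normalization.
  have h1 : (∑ k, star (c k) * c k) * (star φ ⬝ᵥ φ) = star ψ ⬝ᵥ ψ := by
    have : ∀ k, star (c k) * c k * (star φ ⬝ᵥ φ) = star ψ ⬝ᵥ (((K k)ᴴ * K k) *ᵥ ψ) := by
      intro k
      rw [← Matrix.mulVec_mulVec, Matrix.dotProduct_mulVec, ← Matrix.star_mulVec, hc, star_smul,
        smul_dotProduct, dotProduct_smul, smul_eq_mul, smul_eq_mul, mul_assoc]
    rw [Finset.sum_mul, Finset.sum_congr rfl fun k _ => this k, ← dotProduct_sum,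
      ← Matrix.sum_mulVec, hK, Matrix.one_mulVec]
  have hφ' : star φ ⬝ᵥ φ ≠ 0 := fun h => hψ' (by rw [← h1, h, mul_zero])
  have h2 : ∀ k, K k * pureDensity ψ * (K k)ᴴ
      = ((star ψ ⬝ᵥ ψ)⁻¹ * (star (c k) * c k)) • Matrix.vecMulVec φ (star φ) := by
    intro k
    rw [pureDensity, Matrix.mul_smul, Matrix.smul_mul, Matrix.mul_vecMulVec,
      Matrix.vecMulVec_mul, ← Matrix.star_mulVec, hc, star_smul, Matrix.vecMulVec_smul,
      Matrix.smul_vecMulVec, smul_smul, smul_smul, mul_assoc]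
  change ∑ k, K k * pureDensity ψ * (K k)ᴴ = _
  rw [Finset.sum_congr rfl fun k _ => h2 k, ← Finset.sum_smul, ← Finset.mul_sum, pureDensity]
  congr 1
  rw [← h1]
  have : ∑ k, star (c k) * c k ≠ 0 := fun h => hψ' (by rw [← h1, h, zero_mul])
  field_simp

/-- Kraus operators that convert `ψ` into `φ` map `ψ` to multiples of `φ`. -/
theorem exists_smul_of_krausMap_pureDensity {n m : ℕ} {K : Fin m → QubitOp n}
    {ψ φ : QubitVec n} (hψ : ψ ≠ 0) (h : krausMap K (pureDensity ψ) = pureDensity φ)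
    (k : Fin m) : ∃ c : ℂ, K k *ᵥ ψ = c • φ := by
  -- For v orthogonal to φ, the expectation of the output in v is zero, yet it is a positive
  -- multiple of the sum of the |⟨v, K j ψ⟩|²; so each term vanishes.
  have key : ∀ v : QubitVec n, star v ⬝ᵥ φ = 0 → star v ⬝ᵥ (K k *ᵥ ψ) = 0 := by
    intro v hv
    have h1 : ∀ j, star v ⬝ᵥ ((K j * pureDensity ψ * (K j)ᴴ) *ᵥ v)
        = (star ψ ⬝ᵥ ψ)⁻¹ * (Complex.normSq (star v ⬝ᵥ (K j *ᵥ ψ)) : ℂ) := by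
      intro j
      have h2 : star (K j *ᵥ ψ) ⬝ᵥ v = star (star v ⬝ᵥ (K j *ᵥ ψ)) := by
        rw [Matrix.star_dotProduct]
      rw [pureDensity, Matrix.mul_smul, Matrix.smul_mul, Matrix.mul_vecMulVec,
        Matrix.vecMulVec_mul, ← Matrix.star_mulVec, Matrix.smul_mulVec, Matrix.vecMulVec_mulVec,
        h2, dotProduct_smul, smul_eq_mul, op_smul_eq_smul, dotProduct_smul,
        smul_eq_mul, Complex.normSq_eq_conj_mul_self]
      rfl
    have h3 : ∑ j, star v ⬝ᵥ ((K j * pureDensity ψ * (K j)ᴴ) *ᵥ v) = 0 := by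
      rw [← dotProduct_sum, ← Matrix.sum_mulVec]
      change star v ⬝ᵥ (krausMap K (pureDensity ψ) *ᵥ v) = 0
      rw [h, pureDensity, Matrix.smul_mulVec, Matrix.vecMulVec_mulVec, dotProduct_smul,
        op_smul_eq_smul, dotProduct_smul, hv, smul_zero, smul_zero]
    rw [Finset.sum_congr rfl fun j _ => h1 j, ← Finset.mul_sum, mul_eq_zero,
      or_iff_right (inv_ne_zero (mt star_dotProduct_self_eq_zero_iff.mp hψ))] at h3
    norm_cast at h3
    rw [Finset.sum_eq_zero_iff_of_nonneg fun j _ => Complex.normSq_nonneg _] at h3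
    exact Complex.normSq_eq_zero.mp (h3 k (Finset.mem_univ k))
  set u := K k *ᵥ ψ with hu
  -- The coefficient of the orthogonal projection onto φ. The residual is orthogonal to φ, hence by
  -- `key` to u, hence to itself. For φ = 0 the quotient is 0 and the argument still runs.
  refine ⟨(star φ ⬝ᵥ u) / (star φ ⬝ᵥ φ), ?_⟩
  set c := (star φ ⬝ᵥ u) / (star φ ⬝ᵥ φ) with hc
  have h1 : star φ ⬝ᵥ (u - c • φ) = 0 := by
    by_cases hφ : star φ ⬝ᵥ φ = 0
    · simp [star_dotProduct_self_eq_zero_iff.mp hφ]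
    · rw [dotProduct_sub, dotProduct_smul, smul_eq_mul, hc]
      field_simp
      ring
  have h2 : star (u - c • φ) ⬝ᵥ φ = 0 := by
    rw [Matrix.star_dotProduct, star_eq_zero]
    exact h1
  have h3 : star (u - c • φ) ⬝ᵥ (u - c • φ) = 0 := by
    rw [dotProduct_sub, key _ h2, dotProduct_smul, h2, smul_zero, sub_zero]
  exact sub_eq_zero.mp (star_dotProduct_self_eq_zero_iff.mp h3)

/-! ### Shift operators and the action of the generators on the ring state. -/

/-- The matrices supported on the entries `(x, x + e)`. -/
def IsShiftOp {ι : Type*} [Add ι] (e : ι) (M : Matrix ι ι ℂ) : Prop :=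
  ∀ x y, y ≠ x + e → M x y = 0

theorem IsShiftOp.mul {ι : Type*} [AddSemigroup ι] [Fintype ι] {e f : ι} {M N : Matrix ι ι ℂ}
    (hM : IsShiftOp e M) (hN : IsShiftOp f N) : IsShiftOp (e + f) (M * N) := by
  intro x y hxy
  rw [Matrix.mul_apply]
  refine Finset.sum_eq_zero fun z _ => ?_
  by_cases hz : z = x + e
  · subst hz
    rw [hN _ _ (by rwa [add_assoc]), mul_zero]
  · rw [hM _ _ hz, zero_mul]

theorem isShiftOp_one {ι : Type*} [AddMonoid ι] [DecidableEq ι] :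
    IsShiftOp (0 : ι) (1 : Matrix ι ι ℂ) := by
  intro x y hxy
  rw [add_zero] at hxy
  exact Matrix.one_apply_ne' hxy

theorem IsShiftOp.tensorOp {n : ℕ} {e : QubitIndex n} {A : Fin n → Matrix (Fin 2) (Fin 2) ℂ}
    (hA : ∀ j, IsShiftOp (e j) (A j)) : IsShiftOp e (tensorOp A) := by
  intro x y hxy
  obtain ⟨j, hj⟩ := Function.ne_iff.mp hxy
  exact Finset.prod_eq_zero (Finset.mem_univ j) (hA j _ _ hj)

theorem isShiftOp_pauliX : IsShiftOp 1 pauliX := by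
  intro x y hxy
  fin_cases x <;> fin_cases y <;> simp_all [pauliX]

theorem isShiftOp_pauliZ : IsShiftOp 0 pauliZ := by
  intro x y hxy
  fin_cases x <;> fin_cases y <;> simp_all [pauliZ]

theorem isShiftOp_ringFactor (i j : Fin 5) :
    IsShiftOp ((Pi.single i 1 : QubitIndex 5) j) (ringFactor i j) := by
  unfold ringFactor
  split_ifs with h1 h2
  · subst h1
    rw [Pi.single_eq_same]
    exact isShiftOp_pauliX
  · rw [Pi.single_eq_of_ne h1]
    exact isShiftOp_pauliZ
  · rw [Pi.single_eq_of_ne h1]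
    exact isShiftOp_one

/-- The sign of the amplitudes of the ring graph state. -/
def ringSign (x : QubitIndex 5) : ℤ := ∏ i : Fin 5, (-1) ^ ((x i : ℕ) * (x (i + 1) : ℕ))

theorem ringState_apply (x : QubitIndex 5) :
    ringState x = ((Real.sqrt (2 ^ 5))⁻¹ : ℝ) * (ringSign x : ℂ) := by
  simp [ringState, ringSign]

theorem ringState_apply_ne_zero (x : QubitIndex 5) : ringState x ≠ 0 := by
  rw [ringState]
  refine mul_ne_zero ?_ (Finset.prod_ne_zero_iff.mpr fun i _ => pow_ne_zero _ (by simp))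
  rw [Complex.ofReal_ne_zero]
  positivity

theorem ringState_ne_zero : ringState ≠ 0 := fun h =>
  ringState_apply_ne_zero 0 (congrFun h 0)

theorem ringFactor_apply_add_single (i j : Fin 5) (x : QubitIndex 5) :
    ringFactor i j (x j) ((x + Pi.single i 1 : QubitIndex 5) j)
      = ((if j = i - 1 ∨ j = i + 1 then (-1) ^ (x j : ℕ) else 1 : ℤ) : ℂ) := by
  have hX : ∀ p : Fin 2, pauliX p (p + 1) = 1 := by
    intro p; fin_cases p <;> simp [pauliX]
  have hZ : ∀ p : Fin 2, pauliZ p p = (-1) ^ (p : ℕ) := by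
    intro p; fin_cases p <;> simp [pauliZ]
  have hi : ∀ i : Fin 5, ¬(i = i - 1 ∨ i = i + 1) := by decide
  rw [Pi.add_apply]
  by_cases h : j = i
  · subst h
    rw [if_neg (hi j), Pi.single_eq_same, ringFactor, if_pos rfl, hX, Int.cast_one]
  · rw [Pi.single_eq_of_ne h, add_zero, ringFactor, if_neg h]
    split_ifs <;> simp [hZ]

theorem ringA_mulVec_ringState (i : Fin 5) : (ringA i : QubitOp 5) *ᵥ ringState = ringState := by
  ext x
  change ∑ y, tensorOp (ringFactor i) x y * ringState y = _
  have h : IsShiftOp (Pi.single i 1) (tensorOp (ringFactor i)) :=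
    IsShiftOp.tensorOp (isShiftOp_ringFactor i)
  rw [Finset.sum_eq_single (x + Pi.single i 1) (fun y _ hy => by rw [h x y hy, zero_mul])
    (fun h => absurd (Finset.mem_univ _) h)]
  -- With amplitudes reduced to integer signs, invariance is a finite check over 5 generators and 32
  -- bit strings.
  have h2 : ∀ (i : Fin 5) (x : QubitIndex 5),
      (∏ j, if j = i - 1 ∨ j = i + 1 then (-1) ^ (x j : ℕ) else 1 : ℤ)
        * ringSign (x + Pi.single i 1) = ringSign x := by decide +kernel
  rw [ringState_apply, ringState_apply, ← h2 i x, Int.cast_mul, Int.cast_prod, tensorOp,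
    Matrix.of_apply, Finset.prod_congr rfl fun j _ => ringFactor_apply_add_single i j x]
  ring

theorem closure_ringA_mulVec {S : GL (QubitIndex 5) ℂ}
    (hS : S ∈ Subgroup.closure (Set.range ringA)) : (S : QubitOp 5) *ᵥ ringState = ringState := by
  induction hS using Subgroup.closure_induction with
  | mem x hx =>
    obtain ⟨i, rfl⟩ := hx
    exact ringA_mulVec_ringState i
  | one => simp
  | mul x y _ _ hx hy => rw [Units.val_mul, ← Matrix.mulVec_mulVec, hy, hx]
  | inv x _ hx =>
    conv_lhs => rw [← hx, Matrix.mulVec_mulVec, ← Units.val_mul, inv_mul_cancel]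
    simp

/-- Generator i flips exactly bit i, and shifts add under multiplication, so the realizable shifts
form a submonoid containing every unit vector. -/
theorem exists_mem_closure_ringA_isShiftOp (e : QubitIndex 5) :
    ∃ T ∈ Subgroup.closure (Set.range ringA), IsShiftOp e (T : QubitOp 5) := by
  let P : AddSubmonoid (QubitIndex 5) :=
    { carrier := {e | ∃ T ∈ Subgroup.closure (Set.range ringA), IsShiftOp e (T : QubitOp 5)}
      zero_mem' := ⟨1, one_mem _, isShiftOp_one⟩
      add_mem' := by
        rintro e f ⟨S, hS, hSe⟩ ⟨T, hT, hTf⟩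
        exact ⟨S * T, mul_mem hS hT, by rw [Units.val_mul]; exact hSe.mul hTf⟩ }
  change e ∈ P
  rw [← Finset.univ_sum_single e]
  refine P.sum_mem fun i _ => ?_
  obtain h | h : e i = 0 ∨ e i = 1 := by omega
  · rw [h, Pi.single_zero]
    exact P.zero_mem
  · rw [h]
    exact ⟨ringA i, Subgroup.subset_closure ⟨i, rfl⟩, IsShiftOp.tensorOp (isShiftOp_ringFactor i)⟩

theorem qubitIndex_add_self {n : ℕ} (e : QubitIndex n) : e + e = 0 := by
  ext j
  have : ∀ p : Fin 2, p + p = 0 := by decide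
  simp [this]

/-- A diagonal operator fixing a vector without zero amplitudes has only ones on the diagonal. -/
theorem eq_one_of_isShiftOp_zero {S : GL (QubitIndex 5) ℂ}
    (hS : (S : QubitOp 5) *ᵥ ringState = ringState) (hS0 : IsShiftOp 0 (S : QubitOp 5)) :
    S = 1 := by
  ext x y
  by_cases hxy : y = x
  · subst hxy
    have h := congrFun hS y
    rw [Matrix.mulVec, dotProduct, Finset.sum_eq_single y
      (fun z _ hz => by rw [hS0 y z (by rwa [add_zero]), zero_mul])
      (fun h => absurd (Finset.mem_univ _) h)] at h
    rw [Units.val_one, Matrix.one_apply_eq]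
    exact mul_right_cancel₀ (ringState_apply_ne_zero y) (by rw [h, one_mul])
  · rw [hS0 x y (by rwa [add_zero]), Units.val_one, Matrix.one_apply_ne' hxy]

/-- A stabilizer element of the ring state that permutes the computational basis up to factors
is a product of the generators. -/
theorem mem_closure_ringA_of_isShiftOp {S : GL (QubitIndex 5) ℂ} {e : QubitIndex 5}
    (hS : (S : QubitOp 5) *ᵥ ringState = ringState) (hSe : IsShiftOp e (S : QubitOp 5)) :
    S ∈ Subgroup.closure (Set.range ringA) := by
  obtain ⟨T, hT, hTe⟩ := exists_mem_closure_ringA_isShiftOp e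
  -- Both have shift e and e + e = 0, so the product is diagonal.
  have h : S * T = 1 := by
    refine eq_one_of_isShiftOp_zero ?_ ?_
    · rw [Units.val_mul, ← Matrix.mulVec_mulVec, closure_ringA_mulVec hT, hS]
    · rw [Units.val_mul, ← qubitIndex_add_self e]
      exact hSe.mul hTe
  rw [eq_inv_of_mul_eq_one_left h]
  exact inv_mem hT

/-! ### Local stabilizer: rotation symmetry and the cut between qubits 0,1,2 and 3,4. -/

theorem ringState_comp_add (k : Fin 5) (x : QubitIndex 5) :
    ringState (fun j => x (j + k)) = ringState x := by
  unfold ringState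
  congr 1
  refine Fintype.prod_equiv (Equiv.addRight k) _ _ fun i => ?_
  simp [add_right_comm]

/-- Rotation carries a result about the factor `s 0` to every `s k`. -/
theorem tensorOp_comp_add_mulVec_ringState {s : Fin 5 → Matrix (Fin 2) (Fin 2) ℂ}
    (hs : tensorOp s *ᵥ ringState = ringState) (k : Fin 5) :
    tensorOp (fun j => s (j + k)) *ᵥ ringState = ringState := by
  ext x
  have h := congrFun hs (fun j => x (j - k))
  rw [← ringState_comp_add k] at h
  simp only [add_sub_cancel_right] at h
  rw [← h]
  change ∑ y, tensorOp (fun j => s (j + k)) x y * ringState y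
    = ∑ y, tensorOp s (fun j => x (j - k)) y * ringState y
  refine Fintype.sum_equiv (Equiv.arrowCongr (Equiv.addRight k) (Equiv.refl (Fin 2))) _ _
    fun y => ?_
  have h1 : ∀ j, (Equiv.arrowCongr (Equiv.addRight k) (Equiv.refl (Fin 2)) y) (j + k) = y j := by
    intro j
    simp [Equiv.arrowCongr]
  rw [← ringState_comp_add k (Equiv.arrowCongr (Equiv.addRight k) (Equiv.refl (Fin 2)) y)]
  simp only [h1, tensorOp, Matrix.of_apply]
  congr 1
  refine Fintype.prod_equiv (Equiv.addRight k) _ _ fun j => ?_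
  rw [Equiv.coe_addRight, h1, add_sub_cancel_right]

/-- The operator that replaces the last two qubits by `|00⟩⟨uv|`. -/
def lastTwo (u v : Fin 2) : QubitOp 5 :=
  tensorOp ![1, 1, 1, Matrix.single 0 u 1, Matrix.single 0 v 1]

theorem lastTwo_mulVec (u v : Fin 2) (f : QubitVec 5) (x : QubitIndex 5) :
    (lastTwo u v *ᵥ f) x
      = if x 3 = 0 ∧ x 4 = 0 then f ![x 0, x 1, x 2, u, v] else 0 := by
  rw [Matrix.mulVec, dotProduct, Finset.sum_eq_single ![x 0, x 1, x 2, u, v]]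
  · have h : lastTwo u v x ![x 0, x 1, x 2, u, v] = if x 3 = 0 ∧ x 4 = 0 then 1 else 0 := by
      rw [lastTwo, tensorOp, Matrix.of_apply, Fin.prod_univ_five]
      change (1 : Matrix (Fin 2) (Fin 2) ℂ) (x 0) (x 0) * (1 : Matrix (Fin 2) (Fin 2) ℂ) (x 1) (x 1)
        * (1 : Matrix (Fin 2) (Fin 2) ℂ) (x 2) (x 2) * Matrix.single 0 u 1 (x 3) u
        * Matrix.single 0 v 1 (x 4) v = _
      simp only [Matrix.one_apply_eq, Matrix.single_apply, and_true, mul_one, ite_and,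
        eq_comm (a := (0 : Fin 2)), mul_ite, mul_zero]
      split_ifs <;> rfl
    rw [h, ite_mul, one_mul, zero_mul]
  · intro y _ hy
    obtain ⟨j, hj⟩ := Function.ne_iff.mp hy
    rw [lastTwo, tensorOp, Matrix.of_apply, Finset.prod_eq_zero (Finset.mem_univ j), zero_mul]
    fin_cases j
    · exact Matrix.one_apply_ne' hj
    · exact Matrix.one_apply_ne' hj
    · exact Matrix.one_apply_ne' hj
    · exact Matrix.single_apply_of_ne _ _ _ _ _ fun h => hj h.2.symm
    · exact Matrix.single_apply_of_ne _ _ _ _ _ fun h => hj h.2.symm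
  · exact fun h => absurd (Finset.mem_univ _) h

/-- A product vector on the first three qubits in the range of the reduced ring state. -/
def ringProductVec (a : Fin 2) : Fin 5 → Fin 2 → ℂ :=
  ![Pi.single a 1, ![1, (-1) ^ (a : ℕ)], Pi.single 0 1, Pi.single 0 1, Pi.single 0 1]

/-- This places the test vector in the reduced support. The factor (-1)^(uv) cancels the edge
between qubits 3 and 4; the remaining sums over u and v are Fourier sums forcing x 2 = 0 and x 0 =
a, whence the 4. -/
theorem tensorVec_ringProductVec (a : Fin 2) :
    ((Real.sqrt (2 ^ 5))⁻¹ * 4 : ℝ) • tensorVec (ringProductVec a)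
      = ∑ u : Fin 2, ∑ v : Fin 2, (((-1) ^ ((u : ℕ) * (v : ℕ) + (a : ℕ) * (v : ℕ)) : ℤ) : ℂ) •
        (lastTwo u v *ᵥ ringState) := by
  have h : ∀ (a : Fin 2) (x : QubitIndex 5),
      (4 : ℤ) * ∏ j, (![Pi.single a 1, ![1, (-1) ^ (a : ℕ)], Pi.single 0 1, Pi.single 0 1,
        Pi.single 0 1] : Fin 5 → Fin 2 → ℤ) j (x j) = ∑ u : Fin 2, ∑ v : Fin 2,
        (-1) ^ ((u : ℕ) * (v : ℕ) + (a : ℕ) * (v : ℕ)) *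
          (if x 3 = 0 ∧ x 4 = 0 then ringSign ![x 0, x 1, x 2, u, v] else 0) := by
    decide +kernel
  ext x
  have hx : tensorVec (ringProductVec a) x
      = ((∏ j, (![Pi.single a 1, ![1, (-1) ^ (a : ℕ)], Pi.single 0 1, Pi.single 0 1,
        Pi.single 0 1] : Fin 5 → Fin 2 → ℤ) j (x j) : ℤ) : ℂ) := by
    rw [tensorVec, Int.cast_prod]
    refine Finset.prod_congr rfl fun j _ => ?_
    have h1 : ∀ b q : Fin 2, (Pi.single b 1 : Fin 2 → ℂ) q
        = (((Pi.single b 1 : Fin 2 → ℤ) q : ℤ) : ℂ) := by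
      intro b q
      by_cases hb : q = b <;> simp [hb]
    have h2 : ∀ q : Fin 2, (![1, (-1) ^ (a : ℕ)] : Fin 2 → ℂ) q
        = (((![1, (-1) ^ (a : ℕ)] : Fin 2 → ℤ) q : ℤ) : ℂ) := by
      intro q
      fin_cases q <;> simp
    fin_cases j
    · exact h1 _ _
    · exact h2 _
    · exact h1 _ _
    · exact h1 _ _
    · exact h1 _ _
  have hx' := congrArg (Int.cast : ℤ → ℂ) (h a x)
  simp only [Finset.sum_apply, Pi.smul_apply, lastTwo_mulVec, hx, ringState_apply]
  generalize (∏ j, (![Pi.single a 1, ![1, (-1) ^ (a : ℕ)], Pi.single 0 1, Pi.single 0 1,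
        Pi.single 0 1] : Fin 5 → Fin 2 → ℤ) j (x j) : ℤ) = p at hx' ⊢
  simp only [Fin.sum_univ_two] at hx' ⊢
  by_cases hc : x 3 = 0 ∧ x 4 = 0
  · simp only [if_pos hc, Complex.real_smul, smul_eq_mul] at hx' ⊢
    push_cast at hx' ⊢
    linear_combination ((Real.sqrt (2 ^ 5) : ℂ))⁻¹ * hx'
  · simp only [if_neg hc, Complex.real_smul, smul_eq_mul] at hx' ⊢
    push_cast at hx' ⊢
    linear_combination ((Real.sqrt (2 ^ 5) : ℂ))⁻¹ * hx'

theorem tensorOp_mul_comm {n : ℕ} {A B : Fin n → Matrix (Fin 2) (Fin 2) ℂ}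
    (h : ∀ j, A j * B j = B j * A j) : tensorOp A * tensorOp B = tensorOp B * tensorOp A := by
  rw [tensorOp_mul, tensorOp_mul, funext h]

/-- The first three factors of a local stabilizer element preserve the `+1` eigenspace of the
generator supported on the first three qubits, on product vectors. -/
theorem ringA_one_tensorOp_mulVec {s : Fin 5 → GL (Fin 2) ℂ}
    (hs : tensorOp (fun j => (s j : Matrix (Fin 2) (Fin 2) ℂ)) *ᵥ ringState = ringState)
    (a : Fin 2) :
    tensorVec (fun j => ringFactor 1 j *ᵥ ((![s 0, s 1, s 2, 1, 1] j : GL (Fin 2) ℂ) :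
        Matrix (Fin 2) (Fin 2) ℂ) *ᵥ ringProductVec a j)
      = tensorVec (fun j => ((![s 0, s 1, s 2, 1, 1] j : GL (Fin 2) ℂ) :
        Matrix (Fin 2) (Fin 2) ℂ) *ᵥ ringProductVec a j) := by
  rw [← tensorOp_mulVec_tensorVec (ringFactor 1), ← tensorOp_mulVec_tensorVec]
  set U := tensorOp fun j => ((![s 0, s 1, s 2, 1, 1] j : GL (Fin 2) ℂ) :
    Matrix (Fin 2) (Fin 2) ℂ) with hU
  set A := tensorOp (ringFactor 1) with hA
  let T := tensorOp fun j => ((![1, 1, 1, (s 3)⁻¹, (s 4)⁻¹] j : GL (Fin 2) ℂ) :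
    Matrix (Fin 2) (Fin 2) ℂ)
  -- Invariance of the state moves the last two factors, inverted, to the other side of the cut.
  have hTU : T *ᵥ ringState = U *ᵥ ringState := by
    conv_lhs => rw [← hs, Matrix.mulVec_mulVec, tensorOp_mul]
    rw [hU]
    congr 2
    funext j
    rw [← Units.val_mul]
    congr 1
    fin_cases j
    · exact one_mul _
    · exact one_mul _
    · exact one_mul _
    · exact inv_mul_cancel _
    · exact inv_mul_cancel _
  have hAT : A * T = T * A := by
    refine tensorOp_mul_comm fun j => ?_
    fin_cases j <;> first
      | exact (mul_one _).trans (one_mul _).symm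
      | exact (one_mul _).trans (mul_one _).symm
  have hAP : ∀ u v, A * lastTwo u v = lastTwo u v * A := by
    intro u v
    refine tensorOp_mul_comm fun j => ?_
    fin_cases j <;> first
      | exact (mul_one _).trans (one_mul _).symm
      | exact (one_mul _).trans (mul_one _).symm
  have hUP : ∀ u v, U * lastTwo u v = lastTwo u v * U := by
    intro u v
    refine tensorOp_mul_comm fun j => ?_
    fin_cases j <;> first
      | exact (mul_one _).trans (one_mul _).symm
      | exact (one_mul _).trans (mul_one _).symm
  have hAs : A *ᵥ ringState = ringState := ringA_mulVec_ringState 1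
  -- Since U commutes with `lastTwo`, it can be replaced by T on the state; A commutes with both
  -- `lastTwo` and T and is then absorbed by the state.
  have hP : ∀ u v, A *ᵥ U *ᵥ lastTwo u v *ᵥ ringState = U *ᵥ lastTwo u v *ᵥ ringState := by
    intro u v
    rw [Matrix.mulVec_mulVec (M := U), hUP, ← Matrix.mulVec_mulVec, ← hTU,
      Matrix.mulVec_mulVec (M := A), hAP, ← Matrix.mulVec_mulVec, Matrix.mulVec_mulVec (M := A),
      hAT, ← Matrix.mulVec_mulVec, hAs]
  have hc : ((Real.sqrt (2 ^ 5))⁻¹ * 4 : ℝ) ≠ 0 := by positivity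
  refine smul_right_injective _ hc ?_
  simp only [← Matrix.mulVec_smul]
  rw [show tensorVec (fun j => ringProductVec a j) = tensorVec (ringProductVec a) from rfl,
    tensorVec_ringProductVec]
  simp only [Matrix.mulVec_sum, Matrix.mulVec_smul, hP]

theorem GL_mulVec_ne_zero (s : GL (Fin 2) ℂ) {v : Fin 2 → ℂ} (hv : v ≠ 0) :
    ∃ x, ((s : Matrix (Fin 2) (Fin 2) ℂ) *ᵥ v) x ≠ 0 := by
  by_contra! h
  apply hv
  have h1 : (s : Matrix (Fin 2) (Fin 2) ℂ) *ᵥ v = 0 := funext h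
  rw [← Matrix.one_mulVec v, ← Units.val_one, ← inv_mul_cancel s, Units.val_mul,
    ← Matrix.mulVec_mulVec, h1, Matrix.mulVec_zero]

/-- A product vector fixed by Z⊗X⊗Z has a Z-eigenvector as first factor, and the first factor here
is column a of `s 0`. -/
theorem localStabilizer_column {s : Fin 5 → GL (Fin 2) ℂ}
    (hs : tensorOp (fun j => (s j : Matrix (Fin 2) (Fin 2) ℂ)) *ᵥ ringState = ringState)
    (a : Fin 2) :
    (s 0 : Matrix (Fin 2) (Fin 2) ℂ) 0 a = 0 ∨ (s 0 : Matrix (Fin 2) (Fin 2) ℂ) 1 a = 0 := by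
  by_contra! hne
  obtain ⟨y, hy⟩ := GL_mulVec_ne_zero (s 1) (v := ![1, (-1) ^ (a : ℕ)])
    (fun h => one_ne_zero (congrFun h 0))
  obtain ⟨z, hz⟩ := GL_mulVec_ne_zero (s 2) (v := Pi.single 0 1)
    (fun h => one_ne_zero (α := ℂ) (by simpa using congrFun h 0))
  have h := ringA_one_tensorOp_mulVec hs a
  have key : ∀ p q r : Fin 2,
      (pauliZ *ᵥ ((s 0 : Matrix (Fin 2) (Fin 2) ℂ) *ᵥ Pi.single a 1)) p
        * (pauliX *ᵥ ((s 1 : Matrix (Fin 2) (Fin 2) ℂ) *ᵥ ![1, (-1) ^ (a : ℕ)])) q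
        * (pauliZ *ᵥ ((s 2 : Matrix (Fin 2) (Fin 2) ℂ) *ᵥ Pi.single 0 1)) r
      = ((s 0 : Matrix (Fin 2) (Fin 2) ℂ) *ᵥ Pi.single a 1) p
        * ((s 1 : Matrix (Fin 2) (Fin 2) ℂ) *ᵥ ![1, (-1) ^ (a : ℕ)]) q
        * ((s 2 : Matrix (Fin 2) (Fin 2) ℂ) *ᵥ Pi.single 0 1) r := by
    intro p q r
    have h1 := congrFun h ![p, q, r, 0, 0]
    simp only [tensorVec, Fin.prod_univ_five] at h1
    have h2 : (((1 : GL (Fin 2) ℂ) : Matrix (Fin 2) (Fin 2) ℂ) *ᵥ Pi.single 0 1 : Fin 2 → ℂ) 0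
      = 1 := by simp
    have h3 : ((1 : Matrix (Fin 2) (Fin 2) ℂ) *ᵥ ((1 : GL (Fin 2) ℂ) : Matrix (Fin 2) (Fin 2) ℂ)
      *ᵥ Pi.single 0 1 : Fin 2 → ℂ) 0 = 1 := by simp
    change _ * _ * _ * ((1 : Matrix (Fin 2) (Fin 2) ℂ) *ᵥ ((1 : GL (Fin 2) ℂ) :
      Matrix (Fin 2) (Fin 2) ℂ) *ᵥ Pi.single 0 1 : Fin 2 → ℂ) 0 * ((1 : Matrix (Fin 2) (Fin 2) ℂ)
      *ᵥ ((1 : GL (Fin 2) ℂ) : Matrix (Fin 2) (Fin 2) ℂ) *ᵥ Pi.single 0 1 : Fin 2 → ℂ) 0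
      = _ * _ * _ * (((1 : GL (Fin 2) ℂ) : Matrix (Fin 2) (Fin 2) ℂ) *ᵥ Pi.single 0 1 :
      Fin 2 → ℂ) 0 * (((1 : GL (Fin 2) ℂ) : Matrix (Fin 2) (Fin 2) ℂ) *ᵥ Pi.single 0 1 :
      Fin 2 → ℂ) 0 at h1
    rw [h2, h3] at h1
    simp only [mul_one] at h1
    exact h1
  have hcol : ∀ p, ((s 0 : Matrix (Fin 2) (Fin 2) ℂ) *ᵥ Pi.single a 1) p
      = (s 0 : Matrix (Fin 2) (Fin 2) ℂ) p a := by
    intro p; simp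
  have hZ : ∀ (v : Fin 2 → ℂ) p, (pauliZ *ᵥ v) p = (-1) ^ (p : ℕ) * v p := by
    intro v p; fin_cases p <;> simp [pauliZ, Matrix.mulVec, dotProduct]
  have hX : ∀ (v : Fin 2 → ℂ) p, (pauliX *ᵥ v) p = v (p + 1) := by
    intro v p; fin_cases p <;> simp [pauliX, Matrix.mulVec, dotProduct]
  simp only [hZ, hX, hcol] at key
  generalize ((s 1 : Matrix (Fin 2) (Fin 2) ℂ) *ᵥ ![1, (-1) ^ (a : ℕ)]) = v at key hy
  -- Rows 0 and 1 see opposite signs from Z. Eliminating the entry `v (y + 1)` makes a product of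
  -- four nonzero numbers vanish.
  have k0 := key 0 y z
  have k1 := key 1 y z
  rw [Fin.val_zero, pow_zero, one_mul] at k0
  rw [Fin.val_one, pow_one] at k1
  refine mul_ne_zero (mul_ne_zero (mul_ne_zero hne.1 hne.2) hy) hz ?_
  linear_combination (-(s 0 : Matrix (Fin 2) (Fin 2) ℂ) 1 a / 2) * k0
    - (s 0 : Matrix (Fin 2) (Fin 2) ℂ) 0 a / 2 * k1

/-- The zeros of the two columns cannot share a row, by the determinant, so the matrix is diagonal
or antidiagonal. -/
theorem localStabilizer_isShiftOp {s : Fin 5 → GL (Fin 2) ℂ}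
    (hs : tensorOp (fun j => (s j : Matrix (Fin 2) (Fin 2) ℂ)) *ᵥ ringState = ringState) :
    ∃ e, IsShiftOp e (s 0 : Matrix (Fin 2) (Fin 2) ℂ) := by
  have h0 := localStabilizer_column hs 0
  have h1 := localStabilizer_column hs 1
  have hdet : (s 0 : Matrix (Fin 2) (Fin 2) ℂ).det ≠ 0 :=
    ((Matrix.isUnit_iff_isUnit_det _).mp (s 0).isUnit).ne_zero
  rw [Matrix.det_fin_two] at hdet
  by_cases h : (s 0 : Matrix (Fin 2) (Fin 2) ℂ) 0 0 = 0
  · have h2 : (s 0 : Matrix (Fin 2) (Fin 2) ℂ) 1 1 = 0 :=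
      h1.resolve_left fun h3 => hdet (by rw [h, h3]; ring)
    refine ⟨1, fun x y hxy => ?_⟩
    fin_cases x <;> fin_cases y <;> first | exact h | exact h2 | exact absurd rfl hxy
  · have h2 := h0.resolve_left h
    have h3 : (s 0 : Matrix (Fin 2) (Fin 2) ℂ) 0 1 = 0 :=
      h1.resolve_right fun h3 => hdet (by rw [h2, h3]; ring)
    refine ⟨0, fun x y hxy => ?_⟩
    fin_cases x <;> fin_cases y <;> first | exact h2 | exact h3 | exact absurd rfl hxy

theorem localStabilizer_subset_closure :
    localStabilizer ringState ⊆ Subgroup.closure (Set.range ringA) := by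
  rintro S ⟨hS, s, hs⟩
  have hS' := hS
  rw [hs] at hS'
  have h : ∀ k, ∃ e, IsShiftOp e (s k : Matrix (Fin 2) (Fin 2) ℂ) := by
    intro k
    have := localStabilizer_isShiftOp (s := fun j => s (j + k))
      (tensorOp_comp_add_mulVec_ringState hS' k)
    rwa [zero_add] at this
  choose e he using h
  refine mem_closure_ringA_of_isShiftOp (e := e) hS ?_
  rw [hs]
  exact IsShiftOp.tensorOp he

/-! ### Comparison with the Pauli stabilizer. -/

theorem pauliStabilizer_subset_localStabilizer {n : ℕ} (ψ : QubitVec (n + 1)) :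
    pauliStabilizer ψ ⊆ localStabilizer ψ := by
  rintro S ⟨hS, c, hc, σ, hσ, h⟩
  refine ⟨hS, ?_⟩
  rw [h]
  refine IsRegularLocalOp.smul ?_ (isRegularLocalOp_tensorOp fun j => isUnit_pauli (hσ j))
  rintro rfl
  rw [mem_phases_iff] at hc
  norm_num at hc

theorem closure_subset_pauliStabilizer :
    (Subgroup.closure (Set.range ringA) : Set (GL (QubitIndex 5) ℂ))
      ⊆ pauliStabilizer ringState := by
  intro S hS
  refine ⟨closure_ringA_mulVec hS, ?_⟩
  -- In the form c⁴ = 1 the phase condition is visibly closed under products and inverses.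
  simp only [mem_phases_iff]
  induction hS using Subgroup.closure_induction with
  | mem x hx =>
    obtain ⟨i, rfl⟩ := hx
    refine ⟨1, one_pow 4, ringFactor i, fun j => ?_, (one_smul _ _).symm⟩
    unfold ringFactor
    split_ifs <;> simp
  | one => exact ⟨1, one_pow 4, fun _ => 1, by simp, by simp [tensorOp_one]⟩
  | mul x y _ _ hx hy =>
    obtain ⟨c, hc, σ, hσ, hx⟩ := hx
    obtain ⟨d, hd, τ, hτ, hy⟩ := hy
    choose f hf μ hμ hm using fun j => pauli_mul_pauli (hσ j) (hτ j)
    refine ⟨c * d * ∏ j, f j, ?_, μ, hμ, ?_⟩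
    · rw [mul_pow, mul_pow, hc, hd, ← Finset.prod_pow, Finset.prod_congr rfl fun j _ => hf j]
      simp
    · rw [Units.val_mul, hx, hy, Matrix.smul_mul, Matrix.mul_smul, tensorOp_mul, funext hm,
        smul_tensorOp, smul_smul, smul_smul, mul_assoc]
  | inv x _ hx =>
    obtain ⟨c, hc, σ, hσ, hx⟩ := hx
    refine ⟨c⁻¹, by rw [inv_pow, hc, inv_one], σ, hσ, ?_⟩
    have hc0 : c ≠ 0 := by
      rintro rfl
      norm_num at hc
    refine Units.inv_eq_of_mul_eq_one_right ?_
    rw [hx, Matrix.smul_mul, Matrix.mul_smul, smul_smul, mul_inv_cancel₀ hc0, one_smul,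
      tensorOp_mul, funext fun j => pauli_mul_self (hσ j), tensorOp_one]

/-! ### The operator H and the projectors Q. -/

/-- Pauli matrices are traceless, so each of the first three factors contributes 2a and each of the
last two contributes 1. -/
theorem trace_ringH_mul_ringA_one (a : ℝ) :
    (ringH a * (ringA 1 : QubitOp 5)).trace = 8 * (a : ℂ) ^ 3 := by
  change (tensorOp _ * tensorOp (ringFactor 1)).trace = _
  rw [tensorOp_mul, trace_tensorOp, Fin.prod_univ_five]
  change (((1 / 2 : ℂ) • 1 + (a : ℂ) • pauliZ) * pauliZ).trace
    * (((1 / 2 : ℂ) • 1 + (a : ℂ) • pauliX) * pauliX).trace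
    * (((1 / 2 : ℂ) • 1 + (a : ℂ) • pauliZ) * pauliZ).trace
    * (((1 / 2 : ℂ) • 1) * (1 : Matrix (Fin 2) (Fin 2) ℂ)).trace
    * (((1 / 2 : ℂ) • 1) * (1 : Matrix (Fin 2) (Fin 2) ℂ)).trace = _
  have hX : pauliX.trace = 0 := by simp [pauliX, Matrix.trace_fin_two]
  have hZ : pauliZ.trace = 0 := by simp [pauliZ, Matrix.trace_fin_two]
  simp only [add_mul, Matrix.smul_mul, one_mul, pauliZ_mul_self, pauliX_mul_self,
    Matrix.trace_add, Matrix.trace_smul, hX, hZ, Matrix.trace_one, Fintype.card_fin, smul_eq_mul]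
  push_cast
  ring

/-- The tensor product of three one-qubit operators with the identity on the last two qubits. -/
def threeOp (p q r : Matrix (Fin 2) (Fin 2) ℂ) : QubitOp 5 := tensorOp ![p, q, r, 1, 1]

theorem threeOp_mul (p q r p' q' r' : Matrix (Fin 2) (Fin 2) ℂ) :
    threeOp p q r * threeOp p' q' r' = threeOp (p * p') (q * q') (r * r') := by
  rw [threeOp, threeOp, tensorOp_mul, threeOp]
  congr 1
  funext j
  fin_cases j
  · rfl
  · rfl
  · rfl
  · exact one_mul _
  · exact one_mul _

theorem threeOp_conjTranspose (p q r : Matrix (Fin 2) (Fin 2) ℂ) :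
    (threeOp p q r)ᴴ = threeOp pᴴ qᴴ rᴴ := by
  rw [threeOp, conjTranspose_tensorOp, threeOp]
  congr 1
  funext j
  fin_cases j
  · rfl
  · rfl
  · rfl
  · exact Matrix.conjTranspose_one
  · exact Matrix.conjTranspose_one

theorem threeOp_apply (p q r : Matrix (Fin 2) (Fin 2) ℂ) (x y : QubitIndex 5) :
    threeOp p q r x y = p (x 0) (y 0) * q (x 1) (y 1) * r (x 2) (y 2)
      * ((1 : Matrix (Fin 2) (Fin 2) ℂ) (x 3) (y 3) * (1 : Matrix (Fin 2) (Fin 2) ℂ) (x 4) (y 4)) := by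
  rw [← mul_assoc, threeOp, tensorOp, Matrix.of_apply, Fin.prod_univ_five]
  rfl

theorem threeOp_smul (c d e : ℂ) (p q r : Matrix (Fin 2) (Fin 2) ℂ) :
    threeOp (c • p) (d • q) (e • r) = (c * d * e) • threeOp p q r := by
  ext x y
  simp only [threeOp_apply, Matrix.smul_apply, smul_eq_mul]
  ring

theorem threeOp_one : threeOp 1 1 1 = 1 := by
  rw [← tensorOp_one, threeOp]
  congr 1
  funext j
  fin_cases j <;> rfl

/-- The eigenprojector `(1 ± σ) / 2` of an involution, with the sign given by `s`. -/
noncomputable def signProj (s : ℂ) (σ : Matrix (Fin 2) (Fin 2) ℂ) : Matrix (Fin 2) (Fin 2) ℂ :=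
  (1 / 2 : ℂ) • (1 + s • σ)

/-- On the s-eigenspace σ acts as s; the products of Q with H and with `ringA 1` reduce to this. -/
theorem signProj_mul {s : ℂ} (hs : s * s = 1) {σ : Matrix (Fin 2) (Fin 2) ℂ} (hσ : σ * σ = 1)
    (c d : ℂ) : signProj s σ * (c • 1 + d • σ) = (c + s * d) • signProj s σ := by
  simp only [signProj, mul_add, add_mul, Matrix.smul_mul, Matrix.mul_smul, one_mul, mul_one, hσ,
    smul_add, smul_smul]
  match_scalars
  · ring
  · linear_combination (-(d / 2)) * hs

theorem signProj_mul_self {s : ℂ} (hs : s * s = 1) {σ : Matrix (Fin 2) (Fin 2) ℂ}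
    (hσ : σ * σ = 1) : signProj s σ * signProj s σ = signProj s σ := by
  conv_lhs => rw [show signProj s σ * signProj s σ
    = signProj s σ * ((1 / 2 : ℂ) • 1 + (s / 2) • σ) by
      congr 1; rw [signProj, smul_add, smul_smul]; congr 2; ring]
  rw [signProj_mul hs hσ, show (1 / 2 + s * (s / 2) : ℂ) = 1 by linear_combination hs / 2, one_smul]

theorem signProj_conjTranspose {s : ℂ} (hs : star s = s) {σ : Matrix (Fin 2) (Fin 2) ℂ}
    (hσ : σᴴ = σ) : (signProj s σ)ᴴ = signProj s σ := by
  rw [signProj, Matrix.conjTranspose_smul, Matrix.conjTranspose_add, Matrix.conjTranspose_smul,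
    Matrix.conjTranspose_one, hs, hσ]
  simp

/-- The signs of the tensor factors of the projectors `ringQ`. -/
def ringQSign : Fin 4 → Fin 3 → ℂ :=
  ![![1, 1, -1], ![1, -1, 1], ![-1, 1, 1], ![-1, -1, -1]]

theorem ringQSign_mul_self (q : Fin 4) (j : Fin 3) : ringQSign q j * ringQSign q j = 1 := by
  fin_cases q <;> fin_cases j <;> simp [ringQSign]

theorem star_ringQSign (q : Fin 4) (j : Fin 3) : star (ringQSign q j) = ringQSign q j := by
  fin_cases q <;> fin_cases j <;> simp [ringQSign]

/-- The sign product is the eigenvalue of Z⊗X⊗Z on the range of Q, which is therefore orthogonal to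
the state. -/
theorem ringQSign_prod (q : Fin 4) : ringQSign q 0 * ringQSign q 1 * ringQSign q 2 = -1 := by
  fin_cases q <;> simp [ringQSign]

theorem ringQ_eq (q : Fin 4) : ringQ q = threeOp (signProj (ringQSign q 0) pauliZ)
    (signProj (ringQSign q 1) pauliX) (signProj (ringQSign q 2) pauliZ) := by
  simp only [signProj, threeOp_smul]
  rw [show (1 / 2 * (1 / 2) * (1 / 2) : ℂ) = 1 / 8 by norm_num]
  fin_cases q <;> simp [ringQ, ringQSign, threeOp, sub_eq_add_neg]

theorem ringQ_conjTranspose (q : Fin 4) : (ringQ q)ᴴ = ringQ q := by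
  simp only [ringQ_eq, threeOp_conjTranspose,
    signProj_conjTranspose (star_ringQSign q _) isHermitian_pauliZ,
    signProj_conjTranspose (star_ringQSign q _) isHermitian_pauliX]

theorem ringQ_mul_self (q : Fin 4) : ringQ q * ringQ q = ringQ q := by
  simp only [ringQ_eq, threeOp_mul, signProj_mul_self (ringQSign_mul_self q _) pauliZ_mul_self,
    signProj_mul_self (ringQSign_mul_self q _) pauliX_mul_self]

theorem signProj_mul_involution {s : ℂ} (hs : s * s = 1) {σ : Matrix (Fin 2) (Fin 2) ℂ}
    (hσ : σ * σ = 1) : signProj s σ * σ = s • signProj s σ := by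
  have h := signProj_mul hs hσ 0 1
  simpa using h

theorem ringA_one_eq : (ringA 1 : QubitOp 5) = threeOp pauliZ pauliX pauliZ := by
  change tensorOp _ = tensorOp _
  congr 1
  funext j
  fin_cases j <;> rfl

theorem ringQ_mulVec_ringState (q : Fin 4) : ringQ q *ᵥ ringState = 0 := by
  have h : ringQ q * (ringA 1 : QubitOp 5) = -ringQ q := by
    rw [ringA_one_eq, ringQ_eq, threeOp_mul,
      signProj_mul_involution (ringQSign_mul_self q _) pauliZ_mul_self,
      signProj_mul_involution (ringQSign_mul_self q _) pauliX_mul_self,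
      signProj_mul_involution (ringQSign_mul_self q _) pauliZ_mul_self, threeOp_smul,
      ringQSign_prod, neg_one_smul]
  have h2 : ringQ q *ᵥ ringState = -(ringQ q *ᵥ ringState) := by
    conv_lhs => rw [← ringA_mulVec_ringState 1, Matrix.mulVec_mulVec, h, Matrix.neg_mulVec]
  exact self_eq_neg.mp h2

/-- The operator `ringH` with signs for the three nontrivial tensor factors. -/
noncomputable def signedRingH (a s t u : ℂ) : QubitOp 5 :=
  (1 / 4 : ℂ) • threeOp ((1 / 2 : ℂ) • 1 + (s * a) • pauliZ) ((1 / 2 : ℂ) • 1 + (t * a) • pauliX)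
    ((1 / 2 : ℂ) • 1 + (u * a) • pauliZ)

theorem ringH_eq (a : ℝ) : ringH a = signedRingH a 1 1 1 := by
  ext x y
  rw [signedRingH, Matrix.smul_apply, threeOp_apply]
  simp only [one_mul]
  have h : ∀ p q : Fin 2, ((1 / 2 : ℂ) • (1 : Matrix (Fin 2) (Fin 2) ℂ)) p q
      = 1 / 2 * (1 : Matrix (Fin 2) (Fin 2) ℂ) p q := fun p q => rfl
  rw [ringH, tensorOp, Matrix.of_apply, Fin.prod_univ_five]
  change _ * _ * _ * ((1 / 2 : ℂ) • (1 : Matrix (Fin 2) (Fin 2) ℂ)) (x 3) (y 3)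
    * ((1 / 2 : ℂ) • (1 : Matrix (Fin 2) (Fin 2) ℂ)) (x 4) (y 4) = _
  rw [h, h, smul_eq_mul]
  change ((1 / 2 : ℂ) • 1 + (a : ℂ) • pauliZ) (x 0) (y 0)
    * ((1 / 2 : ℂ) • 1 + (a : ℂ) • pauliX) (x 1) (y 1)
    * ((1 / 2 : ℂ) • 1 + (a : ℂ) • pauliZ) (x 2) (y 2) * _ * _ = _
  ring

theorem pauliX_conj_pauliZ (b : ℂ) :
    pauliX * ((1 / 2 : ℂ) • 1 + b • pauliZ) * pauliX = (1 / 2 : ℂ) • 1 + (-b) • pauliZ := by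
  rw [mul_add, add_mul, Matrix.mul_smul, Matrix.smul_mul, mul_one, pauliX_mul_self,
    Matrix.mul_smul, Matrix.smul_mul, pauliX_mul_pauliZ, neg_mul, mul_assoc, pauliX_mul_self,
    mul_one, smul_neg, neg_smul]

theorem pauliZ_conj_pauliX (b : ℂ) :
    pauliZ * ((1 / 2 : ℂ) • 1 + b • pauliX) * pauliZ = (1 / 2 : ℂ) • 1 + (-b) • pauliX := by
  rw [mul_add, add_mul, Matrix.mul_smul, Matrix.smul_mul, mul_one, pauliZ_mul_self,
    Matrix.mul_smul, Matrix.smul_mul, mul_assoc, pauliX_mul_pauliZ, mul_neg, ← mul_assoc,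
    pauliZ_mul_self, one_mul, smul_neg, neg_smul]

/-- X meets Z on qubit 0 and Z meets X on qubit 1, so anticommutation flips s and t; the Z on qubit
4 meets a multiple of 1 and squares away. -/
theorem ringA_zero_conj (a s t u : ℂ) :
    (ringA 0 : QubitOp 5) * signedRingH a s t u * (ringA 0 : QubitOp 5)
      = signedRingH a (-s) (-t) u := by
  rw [signedRingH, Matrix.mul_smul, Matrix.smul_mul, signedRingH]
  congr 1
  change tensorOp (ringFactor 0) * tensorOp _ * tensorOp (ringFactor 0) = tensorOp _
  rw [tensorOp_mul, tensorOp_mul]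
  congr 1
  funext j
  rw [neg_mul, neg_mul]
  fin_cases j
  · exact pauliX_conj_pauliZ _
  · exact pauliZ_conj_pauliX _
  · exact (mul_one _).trans (one_mul _)
  · exact (mul_one _).trans (one_mul _)
  · exact (congrArg (· * pauliZ) (mul_one pauliZ)).trans pauliZ_mul_self

theorem ringA_two_conj (a s t u : ℂ) :
    (ringA 2 : QubitOp 5) * signedRingH a s t u * (ringA 2 : QubitOp 5)
      = signedRingH a s (-t) (-u) := by
  rw [signedRingH, Matrix.mul_smul, Matrix.smul_mul, signedRingH]
  congr 1
  change tensorOp (ringFactor 2) * tensorOp _ * tensorOp (ringFactor 2) = tensorOp _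
  rw [tensorOp_mul, tensorOp_mul]
  congr 1
  funext j
  rw [neg_mul, neg_mul]
  fin_cases j
  · exact (mul_one _).trans (one_mul _)
  · exact pauliZ_conj_pauliX _
  · exact pauliX_conj_pauliZ _
  · exact (congrArg (· * pauliZ) (mul_one pauliZ)).trans pauliZ_mul_self
  · exact (mul_one _).trans (one_mul _)

theorem ringQ_conj (a : ℂ) (q : Fin 4) : ringQ q * signedRingH a 1 1 1 * ringQ q
    = (1 / 4 * ((1 / 2 + ringQSign q 0 * a) * (1 / 2 + ringQSign q 1 * a)
      * (1 / 2 + ringQSign q 2 * a))) • ringQ q := by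
  have h : ringQ q * threeOp ((1 / 2 : ℂ) • 1 + (1 * a) • pauliZ)
      ((1 / 2 : ℂ) • 1 + (1 * a) • pauliX) ((1 / 2 : ℂ) • 1 + (1 * a) • pauliZ)
      = ((1 / 2 + ringQSign q 0 * a) * (1 / 2 + ringQSign q 1 * a)
      * (1 / 2 + ringQSign q 2 * a)) • ringQ q := by
    rw [ringQ_eq, threeOp_mul, signProj_mul (ringQSign_mul_self q _) pauliZ_mul_self,
      signProj_mul (ringQSign_mul_self q _) pauliX_mul_self,
      signProj_mul (ringQSign_mul_self q _) pauliZ_mul_self, threeOp_smul]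
    simp only [one_mul]
  rw [signedRingH, Matrix.mul_smul, h, Matrix.smul_mul, Matrix.smul_mul, ringQ_mul_self, smul_smul]

/-- The four sign patterns (s, t, u) are those with product +1: in their sum the terms linear and
quadratic in a cancel, and a³ Z⊗X⊗Z survives beside 1/8. The Q sum to the projector onto the -1
eigenspace of Z⊗X⊗Z. -/
theorem ringKraus_sum_identity (a : ℂ) :
    (2 * a ^ 3) • (ringQ 0 + ringQ 1 + ringQ 2 + ringQ 3)
      + (signedRingH a 1 1 1 + signedRingH a (-1) (-1) 1 + signedRingH a 1 (-1) (-1)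
        + signedRingH a (-1) 1 (-1)) = (1 / 8 + a ^ 3) • (1 : QubitOp 5) := by
  ext x y
  rw [← threeOp_one]
  simp only [ringQ_eq, signedRingH, threeOp_apply, Matrix.add_apply, Matrix.smul_apply, signProj,
    smul_eq_mul]
  have e0 : ringQSign 0 0 = 1 := rfl
  have e1 : ringQSign 0 1 = 1 := rfl
  have e2 : ringQSign 0 2 = -1 := rfl
  have e3 : ringQSign 1 0 = 1 := rfl
  have e4 : ringQSign 1 1 = -1 := rfl
  have e5 : ringQSign 1 2 = 1 := rfl
  have e6 : ringQSign 2 0 = -1 := rfl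
  have e7 : ringQSign 2 1 = 1 := rfl
  have e8 : ringQSign 2 2 = 1 := rfl
  have e9 : ringQSign 3 0 = -1 := rfl
  have e10 : ringQSign 3 1 = -1 := rfl
  have e11 : ringQSign 3 2 = -1 := rfl
  rw [e0, e1, e2, e3, e4, e5, e6, e7, e8, e9, e10, e11]
  ring

/-! ### Completeness of the eight Kraus operators. -/

theorem ringA_conjTranspose (i : Fin 5) : (ringA i : QubitOp 5)ᴴ = (ringA i : QubitOp 5) := by
  change (tensorOp _)ᴴ = tensorOp _
  rw [conjTranspose_tensorOp]
  congr 1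
  funext j
  unfold ringFactor
  split_ifs
  · exact isHermitian_pauliX
  · exact isHermitian_pauliZ
  · exact Matrix.conjTranspose_one

/-- The coefficient is tuned so that its square times the eigenvalue of H on the range of Q gives
all four Q the same weight; the 1/4 comes from the two trailing factors 1/2 of H. -/
theorem ringCoeff₁_sq {a : ℝ} (ha₀ : 0 < a) (ha₁ : a < 1 / 2) :
    ringCoeff₁ a * ringCoeff₁ a * (1 / 4 * ((1 / 2 + a) ^ 2 * (1 / 2 - a)))
      = 2 * a ^ 3 / (1 / 8 + a ^ 3) := by
  have h1 : 0 < 1 / 2 - a := by linarith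
  have h2 : 0 < 1 / 8 + a ^ 3 := by positivity
  have h3 : 0 < 1 / 2 + a := by positivity
  rw [ringCoeff₁]
  generalize 1 / 2 - a = d at h1 ⊢
  generalize 1 / 8 + a ^ 3 = D at h2 ⊢
  generalize 1 / 2 + a = e at h3 ⊢
  rw [mul_mul_mul_comm (2 : ℝ), Real.mul_self_sqrt (by positivity)]
  field_simp
  ring

theorem ringCoeff₄_sq {a : ℝ} (ha₀ : 0 < a) (ha₁ : a < 1 / 2) :
    ringCoeff₄ a * ringCoeff₄ a * (1 / 4 * (1 / 2 - a) ^ 3) = 2 * a ^ 3 / (1 / 8 + a ^ 3) := by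
  have h1 : 0 < 1 / 2 - a := by linarith
  have h2 : 0 < 1 / 8 + a ^ 3 := by positivity
  rw [ringCoeff₄]
  generalize 1 / 2 - a = d at h1 ⊢
  generalize 1 / 8 + a ^ 3 = D at h2 ⊢
  rw [mul_mul_mul_comm (2 : ℝ), Real.mul_self_sqrt (by positivity)]
  field_simp
  ring

theorem ringCoeff₅_sq {a : ℝ} (ha₀ : 0 < a) :
    ringCoeff₅ a * ringCoeff₅ a = 1 / (1 / 8 + a ^ 3) :=
  Real.mul_self_sqrt (by positivity)

theorem conjTranspose_smul_mul_self {n : ℕ} (c : ℝ) (M : QubitOp n) :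
    ((c : ℂ) • M)ᴴ * ((c : ℂ) • M) = ((c * c : ℝ) : ℂ) • (Mᴴ * M) := by
  rw [Matrix.conjTranspose_smul, Matrix.smul_mul, Matrix.mul_smul, smul_smul]
  simp

theorem krausComplete_ringKraus {a : ℝ} (ha₀ : 0 < a) (ha₁ : a < 1 / 2) {h : QubitOp 5}
    (hh : hᴴ * h = ringH a) : KrausComplete (ringKraus a h) := by
  have hmul : ∀ M : QubitOp 5, (h * M)ᴴ * (h * M) = Mᴴ * signedRingH a 1 1 1 * M := by
    intro M
    rw [← ringH_eq, ← hh, Matrix.conjTranspose_mul]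
    simp only [mul_assoc]
  have hQ : ∀ q, (h * ringQ q)ᴴ * (h * ringQ q) = _ := fun q => by
    rw [hmul, ringQ_conjTranspose, ringQ_conj]
  have hA0 : (h * (ringA 0 : QubitOp 5))ᴴ * (h * (ringA 0 : QubitOp 5))
      = signedRingH a (-1) (-1) 1 := by
    rw [hmul, ringA_conjTranspose, ringA_zero_conj]
  have hA2 : (h * (ringA 2 : QubitOp 5))ᴴ * (h * (ringA 2 : QubitOp 5))
      = signedRingH a 1 (-1) (-1) := by
    rw [hmul, ringA_conjTranspose, ringA_two_conj]
  -- The sign of the X term is flipped twice, that of each Z term once.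
  have hA02 : (h * (ringA 0 : QubitOp 5) * (ringA 2 : QubitOp 5))ᴴ
      * (h * (ringA 0 : QubitOp 5) * (ringA 2 : QubitOp 5)) = signedRingH a (-1) 1 (-1) := by
    rw [Matrix.conjTranspose_mul, mul_assoc, ← mul_assoc _ (h * _) _, hA0, ringA_conjTranspose,
      ← mul_assoc, ringA_two_conj, neg_neg]
  have hD : ((1 / 8 + a ^ 3 : ℝ) : ℂ) ≠ 0 := by
    rw [Complex.ofReal_ne_zero]
    positivity
  have h1 := congrArg Complex.ofReal (ringCoeff₁_sq ha₀ ha₁)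
  have h4 := congrArg Complex.ofReal (ringCoeff₄_sq ha₀ ha₁)
  have h5 := congrArg Complex.ofReal (ringCoeff₅_sq ha₀)
  have k1 : ∀ q : Fin 4, q ≠ 3 → ((ringCoeff₁ a * ringCoeff₁ a : ℝ) : ℂ)
      * (1 / 4 * ((1 / 2 + ringQSign q 0 * a) * (1 / 2 + ringQSign q 1 * a)
      * (1 / 2 + ringQSign q 2 * a))) = ((2 * a ^ 3 / (1 / 8 + a ^ 3) : ℝ) : ℂ) := by
    intro q hq
    rw [← h1]
    fin_cases q
    · change ((ringCoeff₁ a * ringCoeff₁ a : ℝ) : ℂ) * (1 / 4 * ((1 / 2 + 1 * (a : ℂ)) * (1 / 2 + 1 * (a : ℂ))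
        * (1 / 2 + -1 * (a : ℂ)))) = _
      push_cast
      ring
    · change ((ringCoeff₁ a * ringCoeff₁ a : ℝ) : ℂ) * (1 / 4 * ((1 / 2 + 1 * (a : ℂ)) * (1 / 2 + -1 * (a : ℂ))
        * (1 / 2 + 1 * (a : ℂ)))) = _
      push_cast
      ring
    · change ((ringCoeff₁ a * ringCoeff₁ a : ℝ) : ℂ) * (1 / 4 * ((1 / 2 + -1 * (a : ℂ)) * (1 / 2 + 1 * (a : ℂ))
        * (1 / 2 + 1 * (a : ℂ)))) = _
      push_cast
      ring
    · exact absurd rfl hq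
  have k4 : ((ringCoeff₄ a * ringCoeff₄ a : ℝ) : ℂ)
      * (1 / 4 * ((1 / 2 + ringQSign 3 0 * a) * (1 / 2 + ringQSign 3 1 * a)
      * (1 / 2 + ringQSign 3 2 * a))) = ((2 * a ^ 3 / (1 / 8 + a ^ 3) : ℝ) : ℂ) := by
    rw [← h4]
    change ((ringCoeff₄ a * ringCoeff₄ a : ℝ) : ℂ) * (1 / 4 * ((1 / 2 + -1 * (a : ℂ)) * (1 / 2 + -1 * (a : ℂ))
        * (1 / 2 + -1 * (a : ℂ)))) = _
    push_cast
    ring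
  have hsum : ∑ k, (ringKraus a h k)ᴴ * ringKraus a h k
      = ((2 * a ^ 3 / (1 / 8 + a ^ 3) : ℝ) : ℂ) • (ringQ 0 + ringQ 1 + ringQ 2 + ringQ 3)
      + ((1 / (1 / 8 + a ^ 3) : ℝ) : ℂ) • (signedRingH a 1 1 1 + signedRingH a (-1) (-1) 1
        + signedRingH a 1 (-1) (-1) + signedRingH a (-1) 1 (-1)) := by
    rw [Fin.sum_univ_eight]
    change ((ringCoeff₁ a : ℂ) • (h * ringQ 0))ᴴ * ((ringCoeff₁ a : ℂ) • (h * ringQ 0))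
      + ((ringCoeff₁ a : ℂ) • (h * ringQ 1))ᴴ * ((ringCoeff₁ a : ℂ) • (h * ringQ 1))
      + ((ringCoeff₁ a : ℂ) • (h * ringQ 2))ᴴ * ((ringCoeff₁ a : ℂ) • (h * ringQ 2))
      + ((ringCoeff₄ a : ℂ) • (h * ringQ 3))ᴴ * ((ringCoeff₄ a : ℂ) • (h * ringQ 3))
      + ((ringCoeff₅ a : ℂ) • h)ᴴ * ((ringCoeff₅ a : ℂ) • h)
      + ((ringCoeff₅ a : ℂ) • (h * (ringA 0 : QubitOp 5)))ᴴ
        * ((ringCoeff₅ a : ℂ) • (h * (ringA 0 : QubitOp 5)))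
      + ((ringCoeff₅ a : ℂ) • (h * (ringA 2 : QubitOp 5)))ᴴ
        * ((ringCoeff₅ a : ℂ) • (h * (ringA 2 : QubitOp 5)))
      + ((ringCoeff₅ a : ℂ) • (h * (ringA 0 : QubitOp 5) * (ringA 2 : QubitOp 5)))ᴴ
        * ((ringCoeff₅ a : ℂ) • (h * (ringA 0 : QubitOp 5) * (ringA 2 : QubitOp 5))) = _
    simp only [conjTranspose_smul_mul_self, hQ, hA0, hA2, hA02, hh, ringH_eq, smul_smul]
    rw [k1 0 (by decide), k1 1 (by decide), k1 2 (by decide), k4, h5]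
    simp only [smul_add]
    abel
  rw [KrausComplete, hsum]
  have key := congrArg (fun M : QubitOp 5 => ((1 / (1 / 8 + a ^ 3) : ℝ) : ℂ) • M)
    (ringKraus_sum_identity a)
  simp only [smul_add _ (_ • _), smul_smul] at key
  have c1 : ((1 / (1 / 8 + a ^ 3) : ℝ) : ℂ) * (1 / 8 + (a : ℂ) ^ 3) = 1 := by
    push_cast at hD ⊢
    exact one_div_mul_cancel hD
  have c2 : ((1 / (1 / 8 + a ^ 3) : ℝ) : ℂ) * (2 * (a : ℂ) ^ 3)
      = ((2 * a ^ 3 / (1 / 8 + a ^ 3) : ℝ) : ℂ) := by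
    push_cast
    ring
  rwa [c1, c2, one_smul] at key

/-! ### A local invertible square root of H. -/

theorem exists_regular_conjTranspose_mul_self {σ : Matrix (Fin 2) (Fin 2) ℂ} (hσ : σ * σ = 1)
    (hσ' : σᴴ = σ) {a : ℝ} (ha₀ : -(1 / 2) < a) (ha₁ : a < 1 / 2) :
    ∃ g : Matrix (Fin 2) (Fin 2) ℂ, IsUnit g ∧ gᴴ * g = (1 / 2 : ℂ) • 1 + (a : ℂ) • σ := by
  set p := Real.sqrt (1 / 2 + a) with hp
  set q := Real.sqrt (1 / 2 - a) with hq
  have hp2 : p * p = 1 / 2 + a := Real.mul_self_sqrt (by linarith)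
  have hq2 : q * q = 1 / 2 - a := Real.mul_self_sqrt (by linarith)
  have hp0 : p ≠ 0 := (Real.sqrt_pos.mpr (by linarith)).ne'
  have hq0 : q ≠ 0 := (Real.sqrt_pos.mpr (by linarith)).ne'
  have hmul : ∀ u v w z : ℂ, (u • 1 + v • σ) * (w • 1 + z • σ)
      = (u * w + v * z) • 1 + (u * z + v * w) • σ := by
    intro u v w z
    simp only [mul_add, add_mul, Matrix.smul_mul, Matrix.mul_smul, one_mul, mul_one, hσ]
    module
  -- The positive root should act as p and q on the +1 and -1 eigenspaces of σ, so x + y = p and x -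
  -- y = q. Then x² - y² = pq ≠ 0 yields the inverse.
  let x : ℂ := (((p + q) / 2 : ℝ) : ℂ)
  let y : ℂ := (((p - q) / 2 : ℝ) : ℂ)
  have hxy : x * x - y * y ≠ 0 := by
    simp only [x, y]
    norm_cast
    rw [show (p + q) / 2 * ((p + q) / 2) - (p - q) / 2 * ((p - q) / 2) = p * q by ring]
    exact mul_ne_zero hp0 hq0
  refine ⟨x • 1 + y • σ, ?_, ?_⟩
  · refine IsUnit.of_mul_eq_one ((x / (x * x - y * y)) • 1 + (-y / (x * x - y * y)) • σ) ?_
    rw [hmul]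
    have e1 : x * (x / (x * x - y * y)) + y * (-y / (x * x - y * y)) = 1 := by
      rw [← div_self hxy]
      ring
    have e2 : x * (-y / (x * x - y * y)) + y * (x / (x * x - y * y)) = 0 := by ring
    rw [e1, e2, one_smul, zero_smul, add_zero]
  · have hs : (x • 1 + y • σ)ᴴ = x • 1 + y • σ := by
      rw [Matrix.conjTranspose_add, Matrix.conjTranspose_smul, Matrix.conjTranspose_smul, hσ',
        Matrix.conjTranspose_one]
      simp [x, y]
    rw [hs, hmul]
    have e1 : x * x + y * y = 1 / 2 := by
      have : (p + q) / 2 * ((p + q) / 2) + (p - q) / 2 * ((p - q) / 2) = 1 / 2 := by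
        linear_combination hp2 / 2 + hq2 / 2
      have := congrArg Complex.ofReal this
      push_cast at this
      simpa [x, y] using this
    have e2 : x * y + y * x = a := by
      have : (p + q) / 2 * ((p - q) / 2) + (p - q) / 2 * ((p + q) / 2) = a := by
        linear_combination hp2 / 2 - hq2 / 2
      have := congrArg Complex.ofReal this
      push_cast at this
      simpa [x, y] using this
    rw [e1, e2]

theorem exists_regular_ringH {a : ℝ} (ha₀ : 0 < a) (ha₁ : a < 1 / 2) :
    ∃ h : QubitOp 5, IsRegularLocalOp h ∧ hᴴ * h = ringH a := by
  obtain ⟨gZ, hZu, hZ⟩ := exists_regular_conjTranspose_mul_self pauliZ_mul_self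
    isHermitian_pauliZ (a := a) (by linarith) ha₁
  obtain ⟨gX, hXu, hX⟩ := exists_regular_conjTranspose_mul_self pauliX_mul_self
    isHermitian_pauliX (a := a) (by linarith) ha₁
  obtain ⟨g, hgu, hg⟩ := exists_regular_conjTranspose_mul_self pauliX_mul_self
    isHermitian_pauliX (a := 0) (by norm_num) (by norm_num)
  rw [Complex.ofReal_zero, zero_smul, add_zero] at hg
  refine ⟨tensorOp ![gZ, gX, gZ, g, g], isRegularLocalOp_tensorOp fun j => ?_, ?_⟩
  · fin_cases j
    · exact hZu
    · exact hXu
    · exact hZu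
    · exact hgu
    · exact hgu
  · rw [conjTranspose_tensorOp, tensorOp_mul, ringH]
    congr 1
    funext j
    fin_cases j
    · exact hZ
    · exact hX
    · exact hZ
    · exact hg
    · exact hg

/-! ### Conversion by SEP. -/

theorem isLocalOp_threeOp (p q r : Matrix (Fin 2) (Fin 2) ℂ) : IsLocalOp (threeOp p q r) :=
  ⟨_, rfl⟩

theorem isLocalOp_ringKraus (a : ℝ) {h : QubitOp 5} (hh : IsLocalOp h) (k : Fin 8) :
    IsLocalOp (ringKraus a h k) := by
  have hQ : ∀ q, IsLocalOp (ringQ q) := fun q => by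
    rw [ringQ_eq]
    exact isLocalOp_threeOp _ _ _
  have hA : ∀ i, IsLocalOp (ringA i : QubitOp 5) := fun i => ⟨_, rfl⟩
  fin_cases k
  · exact (hh.mul (hQ 0)).smul _
  · exact (hh.mul (hQ 1)).smul _
  · exact (hh.mul (hQ 2)).smul _
  · exact (hh.mul (hQ 3)).smul _
  · exact hh.smul _
  · exact (hh.mul (hA 0)).smul _
  · exact (hh.mul (hA 2)).smul _
  · exact ((hh.mul (hA 0)).mul (hA 2)).smul _

theorem krausMap_ringKraus {a : ℝ} (ha₀ : 0 < a) (ha₁ : a < 1 / 2) {h : QubitOp 5}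
    (hh : hᴴ * h = ringH a) :
    krausMap (ringKraus a h) (pureDensity ringState) = pureDensity (h *ᵥ ringState) := by
  refine krausMap_pureDensity (krausComplete_ringKraus ha₀ ha₁ hh) ringState_ne_zero
    ![0, 0, 0, 0, ringCoeff₅ a, ringCoeff₅ a, ringCoeff₅ a, ringCoeff₅ a] fun k => ?_
  have hQ : ∀ (c : ℂ) q, (c • (h * ringQ q)) *ᵥ ringState = (0 : ℂ) • (h *ᵥ ringState) := by
    intro c q
    rw [Matrix.smul_mulVec, ← Matrix.mulVec_mulVec, ringQ_mulVec_ringState, Matrix.mulVec_zero,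
      smul_zero, zero_smul]
  have hA : ∀ (c : ℂ) (M : QubitOp 5) i, (c • (M * (ringA i : QubitOp 5))) *ᵥ ringState
      = c • (M *ᵥ ringState) := by
    intro c M i
    rw [Matrix.smul_mulVec, ← Matrix.mulVec_mulVec, ringA_mulVec_ringState]
  fin_cases k
  · exact hQ _ 0
  · exact hQ _ 1
  · exact hQ _ 2
  · exact hQ _ 3
  · exact Matrix.smul_mulVec _ _ _
  · exact hA _ _ 0
  · exact hA _ _ 2
  · refine (hA _ _ 2).trans ?_
    rw [← Matrix.mulVec_mulVec, ringA_mulVec_ringState]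
    rfl

/-! ### Impossibility by SEP₁. -/

/-- The square of the product of two generators is diagonal and fixes the state, hence is 1; for
involutions this means commuting. -/
theorem ringA_commute (i k : Fin 5) : ringA i * ringA k = ringA k * ringA i := by
  have hA : ∀ i, ringA i * ringA i = 1 := fun i => Units.ext (tensorOp_ringFactor_mul_self i)
  have hE : IsShiftOp (Pi.single i 1 + Pi.single k 1 : QubitIndex 5)
      ((ringA i * ringA k : GL (QubitIndex 5) ℂ) : QubitOp 5) := by
    rw [Units.val_mul]
    exact (IsShiftOp.tensorOp (isShiftOp_ringFactor i)).mul
      (IsShiftOp.tensorOp (isShiftOp_ringFactor k))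
  have h : ringA i * ringA k * (ringA i * ringA k) = 1 := by
    refine eq_one_of_isShiftOp_zero ?_ ?_
    · simp only [Units.val_mul, ← Matrix.mulVec_mulVec, ringA_mulVec_ringState]
    · rw [Units.val_mul, ← qubitIndex_add_self]
      exact hE.mul hE
  rw [eq_inv_of_mul_eq_one_left h, _root_.mul_inv_rev, inv_eq_of_mul_eq_one_left (hA i),
    inv_eq_of_mul_eq_one_left (hA k)]

theorem closure_ringA_commute {S : GL (QubitIndex 5) ℂ}
    (hS : S ∈ Subgroup.closure (Set.range ringA)) : S * ringA 1 = ringA 1 * S := by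
  induction hS using Subgroup.closure_induction with
  | mem x hx =>
    obtain ⟨i, rfl⟩ := hx
    exact ringA_commute i 1
  | one => rw [one_mul, mul_one]
  | mul x y _ _ hx hy => rw [mul_assoc, hy, ← mul_assoc, hx, mul_assoc]
  | inv x _ hx => rw [inv_mul_eq_iff_eq_mul, ← mul_assoc, hx, mul_inv_cancel_right]

theorem closure_ringA_mul_conjTranspose {S : GL (QubitIndex 5) ℂ}
    (hS : S ∈ Subgroup.closure (Set.range ringA)) :
    (S : QubitOp 5) * (S : QubitOp 5)ᴴ = 1 := by
  induction hS using Subgroup.closure_induction with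
  | mem x hx =>
    obtain ⟨i, rfl⟩ := hx
    rw [ringA_conjTranspose]
    exact tensorOp_ringFactor_mul_self i
  | one => simp
  | mul x y _ _ hx hy =>
    rw [Units.val_mul, Matrix.conjTranspose_mul, mul_assoc, ← mul_assoc (y : QubitOp 5), hy,
      one_mul, hx]
  | inv x _ hx =>
    have h1 : ((x⁻¹ : GL (QubitIndex 5) ℂ) : QubitOp 5) = (x : QubitOp 5)ᴴ :=
      Units.inv_eq_of_mul_eq_one_right hx
    rw [h1, Matrix.conjTranspose_conjTranspose]
    exact mul_eq_one_comm.mp hx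

theorem trace_ringA_one : (ringA 1 : QubitOp 5).trace = 0 := by
  change (tensorOp (ringFactor 1)).trace = 0
  rw [trace_tensorOp]
  refine Finset.prod_eq_zero (Finset.mem_univ (1 : Fin 5)) ?_
  change pauliX.trace = 0
  simp [pauliX, Matrix.trace_fin_two]

/-- A regular local operator that maps the ring state to a nonzero multiple of `h ψ` is a multiple
of `h` times a stabilizer element. -/
theorem exists_eq_smul_mul_stabilizer {h K : QubitOp 5} (hh : IsRegularLocalOp h)
    (hK : IsRegularLocalOp K) {c : ℂ} (hc : K *ᵥ ringState = c • (h *ᵥ ringState)) :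
    ∃ S ∈ Subgroup.closure (Set.range ringA), K = c • (h * (S : QubitOp 5)) := by
  obtain ⟨g, hg, hhg, hgh⟩ := hh.exists_inv
  obtain ⟨L, hL, hKL, hLK⟩ := hK.exists_inv
  have hc0 : c ≠ 0 := by
    rintro rfl
    apply ringState_ne_zero
    rw [zero_smul] at hc
    rw [← Matrix.one_mulVec ringState, ← hLK, ← Matrix.mulVec_mulVec, hc, Matrix.mulVec_zero]
  -- S = c⁻¹ h⁻¹ K is local, invertible and fixes the state.
  let S : GL (QubitIndex 5) ℂ :=
    { val := c⁻¹ • (g * K)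
      inv := c • (L * h)
      val_inv := by
        rw [Matrix.smul_mul, Matrix.mul_smul, smul_smul, inv_mul_cancel₀ hc0, one_smul, mul_assoc,
          ← mul_assoc K, hKL, one_mul, hgh]
      inv_val := by
        rw [Matrix.smul_mul, Matrix.mul_smul, smul_smul, mul_inv_cancel₀ hc0, one_smul, mul_assoc,
          ← mul_assoc h, hhg, one_mul, hLK] }
  refine ⟨S, localStabilizer_subset_closure ⟨?_, (hg.mul hK).smul (inv_ne_zero hc0)⟩, ?_⟩
  · change (c⁻¹ • (g * K)) *ᵥ ringState = ringState
    rw [Matrix.smul_mulVec, ← Matrix.mulVec_mulVec, hc, Matrix.mulVec_smul, Matrix.mulVec_mulVec,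
      hgh, Matrix.one_mulVec, smul_smul, inv_mul_cancel₀ hc0, one_smul]
  · change K = c • (h * (c⁻¹ • (g * K)))
    rw [Matrix.mul_smul, smul_smul, mul_inv_cancel₀ hc0, one_smul, ← mul_assoc, hhg, one_mul]

theorem not_convertibleBySEP₁ {a : ℝ} (ha : a ≠ 0) {h : QubitOp 5}
    (hr : IsRegularLocalOp h) (hh : hᴴ * h = ringH a) :
    ¬ ConvertibleBySEP₁ ringState (h *ᵥ ringState) := by
  rintro ⟨Λ, ⟨m, K, hK, hKc, rfl⟩, hΛ⟩
  choose c hc using exists_smul_of_krausMap_pureDensity ringState_ne_zero hΛ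
  choose S hS hKS using fun k => exists_eq_smul_mul_stabilizer hr (hK k) (hc k)
  -- Commuting S past `ringA 1` and cycling the trace brings S Sᴴ = 1 together, so S drops out.
  have htr : ∀ k, ((K k)ᴴ * K k * (ringA 1 : QubitOp 5)).trace
      = (Complex.normSq (c k) : ℂ) * (8 * (a : ℂ) ^ 3) := by
    intro k
    have hcomm : (S k : QubitOp 5) * (ringA 1 : QubitOp 5)
        = (ringA 1 : QubitOp 5) * (S k : QubitOp 5) := by
      rw [← Units.val_mul, closure_ringA_commute (hS k), Units.val_mul]
    have h1 : (K k)ᴴ * K k * (ringA 1 : QubitOp 5) = (star (c k) * c k) •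
        ((S k : QubitOp 5)ᴴ * (ringH a * (ringA 1 : QubitOp 5) * (S k : QubitOp 5))) := by
      rw [hKS k, Matrix.conjTranspose_smul, Matrix.smul_mul, Matrix.mul_smul, smul_smul,
        Matrix.smul_mul, Matrix.conjTranspose_mul, ← hh]
      simp only [mul_assoc, hcomm]
    rw [h1, Matrix.trace_smul, Matrix.trace_mul_comm, mul_assoc, mul_assoc,
      closure_ringA_mul_conjTranspose (hS k), mul_one, trace_ringH_mul_ringA_one,
      Complex.normSq_eq_conj_mul_self, smul_eq_mul]
    rfl
  have hsum : ∑ k, ((K k)ᴴ * K k * (ringA 1 : QubitOp 5)).trace = 0 := by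
    rw [← Matrix.trace_sum, ← Finset.sum_mul, hKc, one_mul, trace_ringA_one]
  rw [Finset.sum_congr rfl fun k _ => htr k, ← Finset.sum_mul, mul_eq_zero,
    or_iff_left (by simp [ha])] at hsum
  norm_cast at hsum
  rw [Finset.sum_eq_zero_iff_of_nonneg fun j _ => Complex.normSq_nonneg _] at hsum
  -- Every weight |c k|² vanishes, so all Kraus operators are zero, against completeness; the empty
  -- family is covered too.
  have hK0 : ∀ k, K k = 0 := fun k => by
    rw [hKS k, Complex.normSq_eq_zero.mp (hsum k (Finset.mem_univ k)), zero_smul]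
  have h1 : (1 : QubitOp 5) = 0 := by
    rw [← hKc]
    exact Finset.sum_eq_zero fun k _ => by rw [hK0 k, mul_zero]
  exact one_ne_zero h1

theorem mainTheorem2 (a : ℝ) (ha₀ : 0 < a) (ha₁ : a < 1 / 2) :
    localStabilizer ringState = pauliStabilizer ringState ∧
    pauliStabilizer ringState
      = (Subgroup.closure (Set.range ringA) : Set (GL (QubitIndex 5) ℂ)) ∧
    (ringH a * (ringA 1 : QubitOp 5)).trace ≠ 0 ∧
    (∀ q, (ringQ q).IsHermitian ∧ ringQ q * ringQ q = ringQ q ∧ ringQ q *ᵥ ringState = 0) ∧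
    (∃ h : QubitOp 5, IsRegularLocalOp h ∧ hᴴ * h = ringH a) ∧
    ∀ h : QubitOp 5, IsRegularLocalOp h → hᴴ * h = ringH a →
      ((∀ k, IsLocalOp (ringKraus a h k)) ∧ KrausComplete (ringKraus a h) ∧
        krausMap (ringKraus a h) (pureDensity ringState) = pureDensity (h *ᵥ ringState)) ∧
      ConvertibleBySEP ringState (h *ᵥ ringState) ∧
      ¬ ConvertibleBySEP₁ ringState (h *ᵥ ringState) := by
  have hpc : pauliStabilizer ringState
      = (Subgroup.closure (Set.range ringA) : Set (GL (QubitIndex 5) ℂ)) :=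
    ((pauliStabilizer_subset_localStabilizer _).trans localStabilizer_subset_closure).antisymm
      closure_subset_pauliStabilizer
  refine ⟨?_, hpc, ?_, fun q => ⟨ringQ_conjTranspose q, ringQ_mul_self q,
    ringQ_mulVec_ringState q⟩, exists_regular_ringH ha₀ ha₁, fun h hr hh => ?_⟩
  · exact (localStabilizer_subset_closure.trans hpc.ge).antisymm
      (pauliStabilizer_subset_localStabilizer _)
  · rw [trace_ringH_mul_ringA_one]
    have : (a : ℂ) ≠ 0 := Complex.ofReal_ne_zero.mpr ha₀.ne'
    simp [this]
  · have hloc := isLocalOp_ringKraus a hr.isLocalOp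
    have hcomp := krausComplete_ringKraus ha₀ ha₁ hh
    have hmap := krausMap_ringKraus ha₀ ha₁ hh
    exact ⟨⟨hloc, hcomp, hmap⟩, ⟨_, ⟨8, _, hloc, hcomp, rfl⟩, hmap⟩,
      not_convertibleBySEP₁ ha₀.ne' hr hh⟩
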